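/- Call a compact convex set $K\subset\mathbb{R}^n$ with non-empty interior a convex body, and let $|K|$ be its Lebesgue measure. Put $$h_{1,K}(y)=\log\int_K e^{\langle x,y\rangle}\frac{dx}{|K|}\quad(y\in\mathbb{R}^n),\qquad \mathcal{C}(K)=\frac{|K|^2}{\det\mathrm{Cov}(K)},$$ where $\mathrm{Cov}_{ij}(K)=\int_K x_ix_j\frac{dx}{|K|}-\int_K x_i\frac{dx}{|K|}\int_K x_j\frac{dx}{|K|}$. For $B>0$ consider the hypothesis $$(\ast_B)\qquad u_{B,K}:=\log\det\nabla^2h_{1,K}+B\,h_{1,K}\ \text{ is a convex function on }\mathbb{R}^n.$$ If there is a constant $B>0$, independent of the dimension, such that $(\ast_B)$ holds for all $n\ge 1$ and all convex bodies $K\subset\mathbb{R}^n$, then Bourgain's slicing conjecture holds: there is a constant $c>0$, independent of the dimension, such that $\mathcal{C}(K)\ge c^n$ for all $n\ge 1$ and all convex bodies $K\subset\mathbb{R}^n$. -/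

import Mathlib

open MeasureTheory

noncomputable section

namespace Slicing

/-- The logarithmic Laplace transform of the uniform probability measure on `K`
(the `L¹`-support function of `K`),
`h_{1,K}(y) = log ((1 / |K|) ∫_K exp ⟨x, y⟩ dx)`. -/
def h₁ {n : ℕ} (K : Set (EuclideanSpace ℝ (Fin n))) (y : EuclideanSpace ℝ (Fin n)) : ℝ :=
  Real.log (∫ x in K, Real.exp (inner ℝ x y) / volume.real K)

/-- The Hessian matrix `∇² f (y) = (∂_i ∂_j f (y))_{i,j}` in the standard coordinates. -/
def hessian {n : ℕ} (f : EuclideanSpace ℝ (Fin n) → ℝ) (y : EuclideanSpace ℝ (Fin n)) :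
    Matrix (Fin n) (Fin n) ℝ :=
  Matrix.of fun i j =>
    fderiv ℝ (fderiv ℝ f) y (EuclideanSpace.single i 1) (EuclideanSpace.single j 1)

/-- `u_{B,K} = log det ∇² h_{1,K} + B h_{1,K}`. -/
def u {n : ℕ} (B : ℝ) (K : Set (EuclideanSpace ℝ (Fin n))) (y : EuclideanSpace ℝ (Fin n)) : ℝ :=
  Real.log (hessian (h₁ K) y).det + B * h₁ K y

/-- The convexity hypothesis with constant `B` for the body `K`: the function `u_{B,K}` is convex
on the whole space. -/
def ConvexityHypothesis {n : ℕ} (B : ℝ) (K : Set (EuclideanSpace ℝ (Fin n))) : Prop :=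
  ConvexOn ℝ Set.univ (u B K)

/-- The covariance matrix of (the uniform probability measure on) `K`. -/
def cov {n : ℕ} (K : Set (EuclideanSpace ℝ (Fin n))) : Matrix (Fin n) (Fin n) ℝ :=
  Matrix.of fun i j =>
    (∫ x in K, x i * x j / volume.real K) -
      (∫ x in K, x i / volume.real K) * (∫ x in K, x j / volume.real K)

/-- `𝒞(K) = |K|² / det Cov(K)`. -/
def calC {n : ℕ} (K : Set (EuclideanSpace ℝ (Fin n))) : ℝ :=
  volume.real K ^ 2 / (cov K).det

/-- Bourgain's slicing conjecture: there is `c > 0`, independent of the dimension, with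
`𝒞(K) ≥ c ^ n` for every `n` and every convex body (compact, convex, with non-empty interior)
`K` in `ℝⁿ`. -/
def SlicingConjecture : Prop :=
  ∃ c : ℝ, 0 < c ∧ ∀ n : ℕ, 1 ≤ n → ∀ K : ConvexBody (EuclideanSpace ℝ (Fin n)),
    (interior (K : Set (EuclideanSpace ℝ (Fin n)))).Nonempty →
      c ^ n ≤ calC (K : Set (EuclideanSpace ℝ (Fin n)))

end Slicing

end

/-! The gradient of `h₁ K` at `y` is the mean of the uniform measure on K tilted by exp⟨·, y⟩, and
its Hessian is the covariance of that tilted measure. Hence the gradient map is injective with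
values in K, and the change of variables formula gives ∫_Q det ∇²h₁ ≤ |K| for every measurable Q.
Convexity of u, used only at 0 as the midpoint of y and -y, bounds the average of det ∇²h₁ at ±y
below by e^{-BD} det Cov(K), provided h₁(y) + h₁(-y) ≤ 2D. So |K| ≥ |Q| e^{-BD} det Cov(K) whenever
Q is symmetric and the bound with D holds on Q (`volume_mul_exp_mul_det_le`).

It remains to find Q with D = O(n) and |Q| at least det Cov(K)^{-1/2}. With S = Cov(K)^{1/2} and b
the barycentre, take Q = {‖Sy‖ ≤ √n}, and replace K by its part K' in the ellipsoid ‖S⁻¹(x-b)‖ ≤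
7√n. Cauchy–Schwarz then gives D = 7n on K'. By Chebyshev K' keeps almost all the volume.
Brunn–Minkowski prevents the lost part from carrying most of a second moment
(`Convex.setAverage_sq_le_of_subset`), so det Cov(K') ≥ 684^{-n} det Cov(K). Altogether |K| ≥
(e^{-7B}/684)^n det Cov(K)^{1/2}; squaring gives the slicing bound. -/

section

/-! ### Prékopa–Leindler and Brunn–Minkowski inequalities for midpoints. -/

open scoped ENNReal Pointwise

/-- One-dimensional Brunn–Minkowski inequality, for midpoints. -/
theorem Real.volume_add_le_two_mul_of_midpoint {A B C : Set ℝ} (hA : MeasurableSet A)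
    (hB : MeasurableSet B) (hAn : A.Nonempty) (hBn : B.Nonempty)
    (h : ∀ a ∈ A, ∀ b ∈ B, (a + b) / 2 ∈ C) : volume A + volume B ≤ 2 * volume C := by
  have half : ∀ (S : Set ℝ) (c : ℝ), volume ((fun x => (x + c) / 2) '' S) = volume S / 2 := by
    intro S c
    have : (fun x : ℝ => (x + c) / 2) '' S = (fun x => c / 2 + x) '' ((2⁻¹ : ℝ) • S) := by
      rw [← Set.image_smul, Set.image_image]
      refine Set.image_congr fun x _ => ?_
      simp only [smul_eq_mul]; ring
    rw [this, Set.image_add_left, measure_preimage_add, Measure.addHaar_smul]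
    simp only [Module.finrank_self, pow_one]
    rw [abs_of_pos (by norm_num), ENNReal.ofReal_inv_of_pos (by norm_num), mul_comm,
      ENNReal.div_eq_inv_mul, mul_comm]
    simp
  have key : ∀ A' B' : Set ℝ, IsCompact A' → IsCompact B' → A' ⊆ A → B' ⊆ B → A'.Nonempty →
      B'.Nonempty → volume A' + volume B' ≤ 2 * volume C := by
    intro A' B' cA cB sA sB nA nB
    -- With a = max A' and b = min B', the sets (A' + b)/2 and (a + B')/2 lie on opposite sides of
    -- (a + b)/2, so they overlap in at most one point. Cutting `C` at that point needs only the
    -- half-line to be measurable, not `C`.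
    obtain ⟨a, haA, ha⟩ := cA.exists_isGreatest nA
    obtain ⟨b, hbB, hb⟩ := cB.exists_isLeast nB
    have h1 : (fun x => (x + b) / 2) '' A' ⊆ C ∩ Set.Iic ((a + b) / 2) := by
      rintro _ ⟨x, hx, rfl⟩
      refine ⟨h x (sA hx) b (sB hbB), ?_⟩
      have := ha hx
      simp only [Set.mem_Iic]; linarith
    have h2 : (fun x => (x + a) / 2) '' B' ⊆ (C \ Set.Iic ((a + b) / 2)) ∪ {(a + b) / 2} := by
      rintro _ ⟨x, hx, rfl⟩
      have hxb := hb hx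
      have hC := h a (sA haA) x (sB hx)
      rw [add_comm] at hC
      rcases eq_or_lt_of_le hxb with rfl | hlt
      · right; simp [add_comm]
      · left; refine ⟨hC, ?_⟩
        simp only [Set.mem_Iic, not_le]; linarith
    have e1 := measure_mono (μ := volume) h1
    have e2 := (measure_mono (μ := volume) h2).trans (measure_union_le _ _)
    rw [half] at e1 e2
    rw [Real.volume_singleton, add_zero] at e2
    have e3 := measure_inter_add_sdiff (μ := volume) C (measurableSet_Iic (a := (a + b) / 2))
    calc volume A' + volume B' = 2 * (volume A' / 2 + volume B' / 2) := by
          rw [mul_add, ENNReal.mul_div_cancel (by simp) (by simp),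
            ENNReal.mul_div_cancel (by simp) (by simp)]
      _ ≤ 2 * volume C := by rw [← e3]; gcongr
  obtain ⟨a, ha⟩ := hAn
  obtain ⟨b, hb⟩ := hBn
  have step : ∀ A' : Set ℝ, IsCompact A' → A' ⊆ A → A'.Nonempty →
      volume A' + volume B ≤ 2 * volume C := by
    intro A' cA sA nA
    have hle : volume A' ≤ 2 * volume C :=
      le_self_add.trans (key A' {b} cA isCompact_singleton sA (by simpa using hb) nA (by simp))
    have : volume B ≤ 2 * volume C - volume A' := by
      refine le_of_forall_lt fun s hs => ?_
      -- Inner regularity may return the empty set; inserting `b` keeps the approximant compact and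
      -- makes it non-empty.
      obtain ⟨B', sB, cB, hsB⟩ := hB.exists_lt_isCompact hs
      refine (hsB.trans_le (measure_mono (Set.subset_insert b B'))).trans_le
        (ENNReal.le_sub_of_add_le_left cA.measure_ne_top ?_)
      exact key A' _ cA (cB.insert b) sA (Set.insert_subset hb sB) nA (Set.insert_nonempty _ _)
    rw [add_comm]
    exact (add_le_add_left this _).trans_eq (tsub_add_cancel_of_le hle)
  have hBle : volume B ≤ 2 * volume C :=
    le_add_self.trans (step {a} isCompact_singleton (by simpa using ha) (by simp))
  rcases eq_or_ne (volume B) ⊤ with hBt | hBt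
  · exact le_of_le_of_eq le_top (top_le_iff.1 (hBt ▸ hBle)).symm
  have : volume A ≤ 2 * volume C - volume B := by
    refine le_of_forall_lt fun r hr => ?_
    obtain ⟨A', sA, cA, hrA⟩ := hA.exists_lt_isCompact hr
    refine (hrA.trans_le (measure_mono (Set.subset_insert a A'))).trans_le
      (ENNReal.le_sub_of_add_le_right hBt ?_)
    exact step _ (cA.insert a) (Set.insert_subset ha sA) (Set.insert_nonempty _ _)
  exact (add_le_add_left this _).trans_eq (tsub_add_cancel_of_le hBle)

theorem ENNReal.mul_le_sq_of_add_le_two_mul {x y z : ℝ≥0∞} (h : x + y ≤ 2 * z) :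
    x * y ≤ z ^ 2 := by
  rcases eq_or_ne z ⊤ with rfl | hz
  · simp
  have hxy : x + y ≠ ⊤ := ne_top_of_le_ne_top (ENNReal.mul_ne_top (by simp) hz) h
  lift z to NNReal using hz
  lift x to NNReal using fun h => hxy (by simp [h])
  lift y to NNReal using fun h => hxy (by simp [h])
  norm_cast at h ⊢
  rw [← NNReal.coe_le_coe] at h ⊢
  push_cast at h ⊢
  nlinarith [sq_nonneg ((x : ℝ) - y), x.2, y.2, z.2]

theorem MeasureTheory.lintegral_eq_lintegral_meas_ofReal_lt {α : Type*} [MeasurableSpace α]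
    (μ : Measure α) {f : α → ℝ≥0∞} (hf : Measurable f) (hf' : ∀ x, f x ≠ ⊤) :
    ∫⁻ x, f x ∂μ = ∫⁻ t in Set.Ioi (0 : ℝ), μ {x | ENNReal.ofReal t < f x} := by
  have h := lintegral_eq_lintegral_meas_lt μ (f := fun x => (f x).toReal)
    (Filter.Eventually.of_forall fun x => ENNReal.toReal_nonneg) hf.ennreal_toReal.aemeasurable
  simp only [ENNReal.ofReal_toReal (hf' _)] at h
  rw [h]
  refine setLIntegral_congr_fun measurableSet_Ioi fun t ht => ?_
  simp only [ENNReal.ofReal_lt_iff_lt_toReal (le_of_lt ht) (hf' _)]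

/-- Layer-cake formula: since both suprema are 1, the level sets of f and g at a height t < 1 are
non-empty, and their midpoints lie in the level set of h, so the one-dimensional Brunn–Minkowski
inequality applies at each height. At heights t ≥ 1 the level sets of f and g are empty. -/
theorem lintegral_add_le_two_mul_of_midpoint {f g h : ℝ → ℝ≥0∞} (hf : Measurable f)
    (hg : Measurable g) (hh : Measurable h) (hf1 : ⨆ x, f x = 1) (hg1 : ⨆ x, g x = 1)
    (hh1 : ∀ x, h x ≤ 1) (H : ∀ x y, f x * g y ≤ h ((x + y) / 2) ^ 2) :
    (∫⁻ x, f x) + ∫⁻ x, g x ≤ 2 * ∫⁻ x, h x := by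
  have hfle : ∀ x, f x ≤ 1 := fun x => hf1 ▸ le_iSup f x
  have hgle : ∀ x, g x ≤ 1 := fun x => hg1 ▸ le_iSup g x
  have one_top : ∀ {x : ℝ≥0∞}, x ≤ 1 → x ≠ ⊤ := fun h => ne_top_of_le_ne_top ENNReal.one_ne_top h
  have anti : ∀ k : ℝ → ℝ≥0∞, Measurable fun t : ℝ => volume {x | ENNReal.ofReal t < k x} :=
    fun k => Antitone.measurable fun s t hst => measure_mono fun x hx =>
      lt_of_le_of_lt (ENNReal.ofReal_le_ofReal hst) hx
  rw [lintegral_eq_lintegral_meas_ofReal_lt _ hf fun x => one_top (hfle x),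
    lintegral_eq_lintegral_meas_ofReal_lt _ hg fun x => one_top (hgle x),
    lintegral_eq_lintegral_meas_ofReal_lt _ hh fun x => one_top (hh1 x),
    ← lintegral_add_left (anti f), ← lintegral_const_mul _ (anti h)]
  refine lintegral_mono fun t => ?_
  rcases lt_or_ge (ENNReal.ofReal t) 1 with ht | ht
  · refine Real.volume_add_le_two_mul_of_midpoint (measurableSet_lt measurable_const hf)
      (measurableSet_lt measurable_const hg) ?_ ?_ ?_
    · exact lt_iSup_iff.1 (hf1.symm ▸ ht)
    · exact lt_iSup_iff.1 (hg1.symm ▸ ht)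
    · intro a ha b hb
      have : ENNReal.ofReal t ^ 2 < h ((a + b) / 2) ^ 2 := by
        rw [sq]
        exact lt_of_lt_of_le (ENNReal.mul_lt_mul ha hb) (H a b)
      exact lt_of_pow_lt_pow_left' 2 this
  · have e1 : {x | ENNReal.ofReal t < f x} = ∅ :=
      Set.eq_empty_of_forall_notMem fun x hx => absurd (hx.trans_le (hfle x)) (not_lt.2 ht)
    have e2 : {x | ENNReal.ofReal t < g x} = ∅ :=
      Set.eq_empty_of_forall_notMem fun x hx => absurd (hx.trans_le (hgle x)) (not_lt.2 ht)
    simp [e1, e2]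

/-- Dividing f and g by their suprema a and b, and h by √(ab), reduces to the additive inequality;
AM–GM then makes it multiplicative. -/
theorem lintegral_mul_le_sq_of_midpoint_of_bounded {f g h : ℝ → ℝ≥0∞} (hf : Measurable f)
    (hg : Measurable g) (hh : Measurable h) (hf1 : ⨆ x, f x ≠ ⊤) (hg1 : ⨆ x, g x ≠ ⊤)
    (H : ∀ x y, f x * g y ≤ h ((x + y) / 2) ^ 2) :
    (∫⁻ x, f x) * ∫⁻ x, g x ≤ (∫⁻ x, h x) ^ 2 := by
  set a := ⨆ x, f x with ha
  set b := ⨆ x, g x with hb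
  rcases eq_or_ne a 0 with ha0 | ha0
  · have : ∀ x, f x = 0 := fun x => le_antisymm (ha0 ▸ le_iSup f x) bot_le
    simp [this]
  rcases eq_or_ne b 0 with hb0 | hb0
  · have : ∀ x, g x = 0 := fun x => le_antisymm (hb0 ▸ le_iSup g x) bot_le
    simp [this]
  set c := (a * b) ^ (2⁻¹ : ℝ) with hc
  have hc2 : c ^ 2 = a * b := by
    rw [hc, ← ENNReal.rpow_natCast, ← ENNReal.rpow_mul]; simp
  have hab0 : a * b ≠ 0 := mul_ne_zero ha0 hb0
  have habt : a * b ≠ ⊤ := ENNReal.mul_ne_top hf1 hg1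
  have hc0 : c ≠ 0 := fun h0 => hab0 (by rw [← hc2, h0]; simp)
  have hct : c ≠ ⊤ := fun h0 => habt (by rw [← hc2, h0]; simp)
  have cancel : ∀ {x : ℝ≥0∞}, x ≠ 0 → x ≠ ⊤ → x * x⁻¹ = 1 := fun h h' => ENNReal.mul_inv_cancel h h'
  have inv2 : c⁻¹ ^ 2 = a⁻¹ * b⁻¹ := by
    rw [← ENNReal.inv_pow, hc2, ENNReal.mul_inv (Or.inl ha0) (Or.inl hf1)]
  -- The rescaled h need not be bounded by 1, but capping it at 1 preserves the midpoint condition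
  -- because the rescaled f and g are at most 1.
  have key := ENNReal.mul_le_sq_of_add_le_two_mul <|
    lintegral_add_le_two_mul_of_midpoint (f := fun x => a⁻¹ * f x)
    (g := fun x => b⁻¹ * g x) (h := fun x => min (c⁻¹ * h x) 1) (hf.const_mul _) (hg.const_mul _)
    ((hh.const_mul _).min measurable_const)
    (by rw [← ENNReal.mul_iSup, ← ha, mul_comm, cancel ha0 hf1])
    (by rw [← ENNReal.mul_iSup, ← hb, mul_comm, cancel hb0 hg1])
    (fun x => min_le_right _ _) (fun x y => by
      have l1 : a⁻¹ * f x ≤ 1 := by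
        rw [← cancel ha0 hf1, mul_comm a]; gcongr; exact le_iSup f x
      have l2 : b⁻¹ * g y ≤ 1 := by
        rw [← cancel hb0 hg1, mul_comm b]; gcongr; exact le_iSup g y
      rcases le_total (c⁻¹ * h ((x + y) / 2)) 1 with h1 | h1
      · rw [min_eq_left h1, mul_pow, inv2, mul_mul_mul_comm]
        gcongr; exact H x y
      · rw [min_eq_right h1, one_pow]; exact mul_le_one' l1 l2)
  rw [lintegral_const_mul _ hf, lintegral_const_mul _ hg] at key
  have key2 : a⁻¹ * (∫⁻ x, f x) * (b⁻¹ * ∫⁻ x, g x) ≤ (c⁻¹ * ∫⁻ x, h x) ^ 2 := by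
    refine key.trans ?_
    rw [← lintegral_const_mul _ hh]
    gcongr
    exact min_le_left _ _
  rw [mul_pow, inv2, mul_mul_mul_comm] at key2
  have hi0 : a⁻¹ * b⁻¹ ≠ 0 := mul_ne_zero (by simpa using hf1) (by simpa using hg1)
  have hit : a⁻¹ * b⁻¹ ≠ ⊤ := ENNReal.mul_ne_top (by simpa using ha0) (by simpa using hb0)
  exact (ENNReal.mul_le_mul_iff_right hi0 hit).1 key2

theorem lintegral_eq_iSup_lintegral_min_nat {α : Type*} [MeasurableSpace α] (μ : Measure α)
    {f : α → ℝ≥0∞} (hf : Measurable f) :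
    ∫⁻ x, f x ∂μ = ⨆ N : ℕ, ∫⁻ x, min (f x) N ∂μ := by
  rw [← lintegral_iSup (fun N => hf.min measurable_const)]
  · refine lintegral_congr fun x => ?_
    rw [← inf_iSup_eq, ENNReal.iSup_natCast]; simp
  · intro M N hMN x
    exact min_le_min le_rfl (by exact_mod_cast hMN)

theorem lintegral_mul_le_sq_of_midpoint {f g h : ℝ → ℝ≥0∞} (hf : Measurable f)
    (hg : Measurable g) (hh : Measurable h) (H : ∀ x y, f x * g y ≤ h ((x + y) / 2) ^ 2) :
    (∫⁻ x, f x) * ∫⁻ x, g x ≤ (∫⁻ x, h x) ^ 2 := by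
  rw [lintegral_eq_iSup_lintegral_min_nat _ hf, lintegral_eq_iSup_lintegral_min_nat _ hg,
    ENNReal.iSup_mul]
  refine iSup_le fun M => ?_
  rw [ENNReal.mul_iSup]
  refine iSup_le fun N => ?_
  have bd : ∀ (k : ℝ → ℝ≥0∞) (N : ℕ), ⨆ x, min (k x) N ≠ ⊤ := fun k N =>
    ne_top_of_le_ne_top (ENNReal.natCast_ne_top N) (iSup_le fun x => min_le_right _ _)
  exact lintegral_mul_le_sq_of_midpoint_of_bounded (hf.min measurable_const)
    (hg.min measurable_const) hh (bd f M) (bd g N) fun x y =>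
      (mul_le_mul' (min_le_left _ _) (min_le_left _ _)).trans (H x y)

/-- The Prékopa–Leindler inequality with weight `1 / 2`. -/
theorem prekopa_leindler_midpoint (n : ℕ) {f g h : (Fin n → ℝ) → ℝ≥0∞} (hf : Measurable f)
    (hg : Measurable g) (hh : Measurable h)
    (H : ∀ x y, f x * g y ≤ h ((2⁻¹ : ℝ) • (x + y)) ^ 2) :
    (∫⁻ x, f x) * ∫⁻ x, g x ≤ (∫⁻ x, h x) ^ 2 := by
  induction n with
  | zero =>
    have e : ∀ k : (Fin 0 → ℝ) → ℝ≥0∞, ∫⁻ x, k x = k 0 := fun k => by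
      rw [volume_pi, Measure.pi_of_empty, lintegral_dirac]
      exact congrArg k (Subsingleton.elim _ _)
    rw [e, e, e]
    have := H 0 0
    rwa [add_zero, smul_zero] at this
  | succ n ih =>
    have mp := (volume_preserving_piFinSuccAbove (fun _ : Fin (n + 1) => ℝ) 0).symm
    set φ := (MeasurableEquiv.piFinSuccAbove (fun _ : Fin (n + 1) => ℝ) 0).symm
    have hφ : ∀ p, φ p = Fin.cons p.1 p.2 := fun p => by
      simp [φ, MeasurableEquiv.piFinSuccAbove, Fin.insertNthEquiv]
    have e : ∀ k : (Fin (n + 1) → ℝ) → ℝ≥0∞, Measurable k →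
        ∫⁻ x, k x = ∫⁻ s, ∫⁻ x, k (φ (s, x)) := fun k hk => by
      rw [← mp.lintegral_comp hk]
      exact lintegral_prod _ (hk.comp φ.measurable).aemeasurable
    have ms : ∀ k : (Fin (n + 1) → ℝ) → ℝ≥0∞, Measurable k →
        Measurable fun s => ∫⁻ x, k (φ (s, x)) := fun k hk =>
      (hk.comp φ.measurable).lintegral_prod_right'
    rw [e f hf, e g hg, e h hh]
    -- The marginals in the first coordinate satisfy the one-dimensional midpoint condition by the
    -- induction hypothesis applied to the slices over s, t and (s + t)/2.
    refine lintegral_mul_le_sq_of_midpoint (ms f hf) (ms g hg) (ms h hh) fun s t => ?_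
    refine ih (hf.comp (φ.measurable.comp measurable_prodMk_left))
      (hg.comp (φ.measurable.comp measurable_prodMk_left))
      (hh.comp (φ.measurable.comp measurable_prodMk_left)) fun x y => ?_
    have := H (φ (s, x)) (φ (t, y))
    convert this using 3
    simp only [hφ]
    ext i
    refine Fin.cases ?_ (fun j => ?_) i
    · simp; ring
    · simp; ring

/-- The multiplicative Brunn–Minkowski inequality for midpoints. -/
theorem EuclideanSpace.volume_mul_le_sq_of_midpoint {n : ℕ} {A B C : Set (EuclideanSpace ℝ (Fin n))}
    (hA : MeasurableSet A) (hB : MeasurableSet B) (hC : MeasurableSet C)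
    (H : ∀ a ∈ A, ∀ b ∈ B, (2⁻¹ : ℝ) • (a + b) ∈ C) :
    volume A * volume B ≤ volume C ^ 2 := by
  have mp := (EuclideanSpace.volume_preserving_symm_measurableEquiv_toLp (Fin n)).symm
  set φ := (MeasurableEquiv.toLp 2 (Fin n → ℝ)).symm.symm
  have e : ∀ S : Set (EuclideanSpace ℝ (Fin n)), MeasurableSet S →
      volume S = ∫⁻ x, (φ ⁻¹' S).indicator 1 x := fun S hS => by
    rw [lintegral_indicator_one (φ.measurable hS), mp.measure_preimage hS.nullMeasurableSet]
  rw [e A hA, e B hB, e C hC]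
  refine prekopa_leindler_midpoint n (measurable_one.indicator (φ.measurable hA))
    (measurable_one.indicator (φ.measurable hB)) (measurable_one.indicator (φ.measurable hC))
    fun x y => ?_
  by_cases hx : x ∈ φ ⁻¹' A
  · by_cases hy : y ∈ φ ⁻¹' B
    · have : (2⁻¹ : ℝ) • (x + y) ∈ φ ⁻¹' C := H _ hx _ hy
      rw [Set.indicator_of_mem hx, Set.indicator_of_mem hy, Set.indicator_of_mem this]
      simp
    · rw [Set.indicator_of_notMem hy]; simp
  · rw [Set.indicator_of_notMem hx]; simp

end

/-! ### Reverse second-moment estimates for linear functionals on convex sets. -/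

section

open scoped ENNReal

variable {n : ℕ}

/-- A tail estimate in the spirit of Borell's lemma. The midpoint of a point with |⟨x, θ⟩ - m| >
(2t+1)r and one with |⟨x, θ⟩ - m| ≤ r has deviation > tr. Brunn–Minkowski gives |tail at 2t+1| ·
(18/19)|K| ≤ |tail at t|², and one factor on the right is at most |K|/19, whence the 18. -/
theorem Convex.volume_tail_le {K : Set (EuclideanSpace ℝ (Fin n))} (hK : Convex ℝ K)
    (hKm : MeasurableSet K) (hKt : volume K ≠ ⊤) (hK0 : volume K ≠ 0)
    (θ : EuclideanSpace ℝ (Fin n)) (m : ℝ) {r : ℝ} (hr : 0 < r)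
    (hY : 19 * volume (K ∩ {x | r < |inner ℝ x θ - m|}) ≤ volume K) {t : ℝ} (ht : 1 ≤ t) :
    18 * volume (K ∩ {x | (2 * t + 1) * r < |inner ℝ x θ - m|}) ≤
      volume (K ∩ {x | t * r < |inner ℝ x θ - m|}) := by
  have hm : ∀ s : ℝ, MeasurableSet {x : EuclideanSpace ℝ (Fin n) | s < |inner ℝ x θ - m|} :=
    fun s => measurableSet_lt measurable_const (by fun_prop)
  have bm := EuclideanSpace.volume_mul_le_sq_of_midpoint
    (A := K ∩ {x | (2 * t + 1) * r < |inner ℝ x θ - m|})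
    (B := K \ {x | r < |inner ℝ x θ - m|}) (C := K ∩ {x | t * r < |inner ℝ x θ - m|})
    (hKm.inter (hm _)) (hKm.diff (hm _)) (hKm.inter (hm _)) (by
      rintro a ⟨haK, ha⟩ b ⟨hbK, hb⟩
      refine ⟨?_, ?_⟩
      · rw [smul_add]
        exact hK haK hbK (by norm_num) (by norm_num) (by norm_num)
      · simp only [Set.mem_ofPred_eq, not_lt, inner_smul_left, inner_add_left] at ha hb ⊢
        have e : (starRingEnd ℝ) 2⁻¹ * (inner ℝ a θ + inner ℝ b θ) - m =
            ((inner ℝ a θ - m) + (inner ℝ b θ - m)) / 2 := by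
          simp only [conj_trivial]; ring
        rw [e, abs_div, abs_two, lt_div_iff₀ two_pos]
        have := abs_sub_abs_le_abs_sub (inner ℝ a θ - m) (-(inner ℝ b θ - m))
        rw [abs_neg, sub_neg_eq_add] at this
        linarith)
  have hmono : volume (K ∩ {x | t * r < |inner ℝ x θ - m|}) ≤
      volume (K ∩ {x | r < |inner ℝ x θ - m|}) := by
    refine measure_mono (Set.inter_subset_inter_right _ fun x hx => ?_)
    simp only [Set.mem_ofPred_eq] at hx ⊢
    nlinarith
  have hsplit := measure_inter_add_sdiff (μ := volume) K (hm r)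
  have fin : ∀ S : Set (EuclideanSpace ℝ (Fin n)), volume (K ∩ S) ≠ ⊤ := fun S =>
    measure_ne_top_of_subset Set.inter_subset_left hKt
  have find : ∀ S : Set (EuclideanSpace ℝ (Fin n)), volume (K \ S) ≠ ⊤ := fun S =>
    measure_ne_top_of_subset Set.sdiff_subset hKt
  revert bm hmono hsplit hY hK0
  lift volume K to NNReal using hKt with V
  lift volume (K ∩ {x | (2 * t + 1) * r < |inner ℝ x θ - m|}) to NNReal using fin _ with a
  lift volume (K \ {x | r < |inner ℝ x θ - m|}) to NNReal using find _ with b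
  lift volume (K ∩ {x | t * r < |inner ℝ x θ - m|}) to NNReal using fin _ with c
  lift volume (K ∩ {x | r < |inner ℝ x θ - m|}) to NNReal using fin _ with d
  norm_cast
  intro hV hd bm hcd hdb
  rw [← NNReal.coe_le_coe] at *
  have hV' : (0 : ℝ) < V := by positivity
  have hdb' : (d : ℝ) + b = V := by exact_mod_cast hdb
  push_cast at *
  have h1 : 18 * (V : ℝ) ≤ 19 * b := by linarith
  have h2 : (18 * (a : ℝ)) * V ≤ c * V := by
    nlinarith [a.2, c.2, mul_le_mul_of_nonneg_left h1 a.2, mul_le_mul_of_nonneg_left hcd c.2,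
      mul_le_mul_of_nonneg_left hd c.2]
  exact le_of_mul_le_mul_right h2 hV'

/-- With Y = |⟨x, θ⟩ - m|/r, let J be the integral of Y² and I that of ((Y-1)/2)² over Y > 3.
Integrating the tail estimate over levels gives 18 I ≤ J. Since Y ≤ 3(Y-1)/2 for Y ≥ 3, also J ≤
9|K| + 9 I. Hence J ≤ 9|K| + J/2; J is finite by compactness, so it can be absorbed. -/
theorem Convex.setIntegral_sq_le_of_volume_le {K : Set (EuclideanSpace ℝ (Fin n))}
    (hK : Convex ℝ K) (hKc : IsCompact K) (hK0 : volume K ≠ 0)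
    (θ : EuclideanSpace ℝ (Fin n)) (m : ℝ) {r : ℝ} (hr : 0 < r)
    (hY : 19 * volume (K ∩ {x | r < |inner ℝ x θ - m|}) ≤ volume K) :
    ∫ x in K, (inner ℝ x θ - m) ^ 2 ≤ 18 * r ^ 2 * volume.real K := by
  set Y : EuclideanSpace ℝ (Fin n) → ℝ := fun x => |inner ℝ x θ - m| / r with hYdef
  have hYm : Measurable Y := by fun_prop
  have hYc : Continuous Y := by fun_prop
  have hY0 : ∀ x, 0 ≤ Y x := fun x => by positivity
  have hset : ∀ s : ℝ, {x | s < Y x} = {x | s * r < |inner ℝ x θ - m|} := fun s => by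
    ext x; simp only [hYdef, Set.mem_ofPred_eq, lt_div_iff₀ hr]
  -- Discarding the values Z ≤ 1 makes every level set have the form Z > max(1, √t), so the tail
  -- estimate is only needed at parameters at least 1.
  set F : (EuclideanSpace ℝ (Fin n) → ℝ) → EuclideanSpace ℝ (Fin n) → ℝ≥0∞ := fun Z x =>
    if 1 < Z x then ENNReal.ofReal (Z x ^ 2) else 0 with hF
  have hFm : ∀ Z, Measurable Z → Measurable (F Z) := fun Z hZ =>
    Measurable.ite (measurableSet_lt measurable_const hZ) (by fun_prop) measurable_const
  have hFt : ∀ Z x, F Z x ≠ ⊤ := fun Z x => by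
    simp only [hF]; split_ifs <;> simp
  have hFlev : ∀ Z : EuclideanSpace ℝ (Fin n) → ℝ, ∀ t : ℝ, 0 < t →
      {x | ENNReal.ofReal t < F Z x} = {x | max 1 (√t) < Z x} := by
    intro Z t ht
    ext x
    simp only [hF, Set.mem_ofPred_eq, max_lt_iff]
    split_ifs with h
    · rw [ENNReal.ofReal_lt_ofReal_iff (by positivity), Real.sqrt_lt' (by linarith)]
      simp [h]
    · simp [h]
  have key : 18 * ∫⁻ x in K, F (fun x => (Y x - 1) / 2) x ≤ ∫⁻ x in K, F Y x := by
    have hm1 : Measurable (fun x => (Y x - 1) / 2) := by fun_prop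
    rw [lintegral_eq_lintegral_meas_ofReal_lt _ (hFm _ hm1) (hFt _),
      lintegral_eq_lintegral_meas_ofReal_lt _ (hFm _ hYm) (hFt _),
      ← lintegral_const_mul' _ _ (by simp)]
    refine setLIntegral_mono' measurableSet_Ioi fun t ht => ?_
    rw [hFlev _ t ht, hFlev _ t ht]
    have e : {x | max 1 √t < (Y x - 1) / 2} = {x | 2 * max 1 √t + 1 < Y x} := by
      ext x; simp only [Set.mem_ofPred_eq]; constructor <;> intro h <;> linarith
    rw [e, Measure.restrict_apply (measurableSet_lt measurable_const hYm),
      Measure.restrict_apply (measurableSet_lt measurable_const hYm), hset, hset,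
      Set.inter_comm _ K, Set.inter_comm _ K]
    exact hK.volume_tail_le hKc.measurableSet hKc.measure_ne_top hK0 θ m hr hY (le_max_left _ _)
  set J := ∫⁻ x in K, ENNReal.ofReal (Y x ^ 2) with hJ
  have hint : IntegrableOn (fun x => Y x ^ 2) K := (hYc.pow 2).continuousOn.integrableOn_compact hKc
  have hJeq : J = ENNReal.ofReal (∫ x in K, Y x ^ 2) :=
    (ofReal_integral_eq_lintegral_ofReal hint (Filter.Eventually.of_forall fun x => sq_nonneg _)).symm
  have h1 : ∫⁻ x in K, F Y x ≤ J := lintegral_mono fun x => by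
    simp only [hF]; split_ifs <;> simp
  have h2 : J ≤ 9 * volume K + 9 * ∫⁻ x in K, F (fun x => (Y x - 1) / 2) x := by
    have hm1 : Measurable (fun x => (Y x - 1) / 2) := by fun_prop
    rw [← lintegral_const_mul' _ _ (by simp), ← setLIntegral_const, ← lintegral_add_left (by fun_prop)]
    refine lintegral_mono fun x => ?_
    simp only [hF]
    split_ifs with h
    · rw [show (9 : ℝ≥0∞) = ENNReal.ofReal 9 by simp, ← ENNReal.ofReal_mul (by norm_num),
        ← ENNReal.ofReal_add (by norm_num) (by positivity)]
      refine ENNReal.ofReal_le_ofReal ?_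
      nlinarith
    · rw [show (9 : ℝ≥0∞) = ENNReal.ofReal 9 by simp, mul_zero, add_zero]
      refine ENNReal.ofReal_le_ofReal ?_
      nlinarith [hY0 x]
  have h3 : J ≤ 18 * volume K := by
    have hJt : J ≠ ⊤ := by rw [hJeq]; exact ENNReal.ofReal_ne_top
    have hIt : ∫⁻ x in K, F (fun x => (Y x - 1) / 2) x ≠ ⊤ := by
      intro h
      rw [h] at key
      exact hJt (top_le_iff.1 ((by simpa using key : (⊤ : ℝ≥0∞) ≤ _).trans h1))
    have hVt := hKc.measure_ne_top (μ := volume)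
    have h4 := key.trans h1
    revert h2 h4
    lift J to NNReal using hJt with J'
    lift (∫⁻ x in K, F (fun x => (Y x - 1) / 2) x) to NNReal using hIt with I
    lift volume K to NNReal using hVt with V
    norm_cast
    intro h2 h4
    rw [← NNReal.coe_le_coe] at *
    push_cast at *
    linarith
  have h5 : ∫ x in K, Y x ^ 2 ≤ 18 * volume.real K := by
    rw [hJeq] at h3
    have := ENNReal.toReal_mono (ENNReal.mul_ne_top (by simp) hKc.measure_ne_top) h3
    rw [ENNReal.toReal_ofReal (integral_nonneg fun x => sq_nonneg _), ENNReal.toReal_mul] at this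
    simpa [Measure.real] using this
  have h6 : ∫ x in K, (inner ℝ x θ - m) ^ 2 = r ^ 2 * ∫ x in K, Y x ^ 2 := by
    rw [← integral_const_mul]
    refine integral_congr_ae (Filter.Eventually.of_forall fun x => ?_)
    simp only [hYdef, div_pow, sq_abs]
    field_simp
  rw [h6]
  nlinarith [sq_nonneg r]

/-- The second moment of a linear functional on a convex body is controlled by its second moment
on a subset of almost full volume. -/
theorem Convex.setAverage_sq_le_of_subset {K K' : Set (EuclideanSpace ℝ (Fin n))}
    (hK : Convex ℝ K) (hKc : IsCompact K) (hK' : IsCompact K') (hsub : K' ⊆ K)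
    (hK0 : 0 < volume.real K) (hvol : 37 * volume.real K ≤ 38 * volume.real K')
    (θ : EuclideanSpace ℝ (Fin n)) (m : ℝ) (hpos : 0 < ∫ x in K', (inner ℝ x θ - m) ^ 2) :
    (∫ x in K, (inner ℝ x θ - m) ^ 2) / volume.real K ≤
      684 * ((∫ x in K', (inner ℝ x θ - m) ^ 2) / volume.real K') := by
  have hV' : 0 < volume.real K' := by linarith
  set v := (∫ x in K', (inner ℝ x θ - m) ^ 2) / volume.real K' with hv
  have hv0 : 0 < v := div_pos hpos hV'
  -- At r = √(38v) Chebyshev leaves at most |K'|/38 of K' beyond r, and K \ K' adds at most |K|/38.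
  -- The total |K|/19 is what the tail estimate requires, and 684 = 18 · 38.
  have hr : 0 < √(38 * v) := by positivity
  have hr2 : √(38 * v) ^ 2 = 38 * v := Real.sq_sqrt (by positivity)
  have hcont : Continuous fun x : EuclideanSpace ℝ (Fin n) => (inner ℝ x θ - m) ^ 2 := by fun_prop
  have cheb := mul_meas_ge_le_integral_of_nonneg (μ := volume.restrict K')
    (f := fun x => (inner ℝ x θ - m) ^ 2) (Filter.Eventually.of_forall fun x => sq_nonneg _)
    (hcont.continuousOn.integrableOn_compact hK') (38 * v)
  have hms : MeasurableSet {x : EuclideanSpace ℝ (Fin n) | √(38 * v) < |inner ℝ x θ - m|} :=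
    measurableSet_lt measurable_const (by fun_prop)
  have hcheb : volume.real (K' ∩ {x | √(38 * v) < |inner ℝ x θ - m|}) ≤ volume.real K' / 38 := by
    have h1 : volume.real (K' ∩ {x | √(38 * v) < |inner ℝ x θ - m|}) ≤
        (volume.restrict K').real {x | 38 * v ≤ (inner ℝ x θ - m) ^ 2} := by
      rw [Set.inter_comm, ← measureReal_restrict_apply hms]
      have : IsFiniteMeasure (volume.restrict K') :=
        ⟨by rw [Measure.restrict_apply_univ]; exact hK'.measure_lt_top⟩
      refine measureReal_mono fun x hx => ?_
      simp only [Set.mem_ofPred_eq] at hx ⊢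
      rw [← sq_abs, ← hr2]
      exact pow_le_pow_left₀ hr.le hx.le 2
    have h2 : 38 * v * volume.real (K' ∩ {x | √(38 * v) < |inner ℝ x θ - m|}) ≤
        v * volume.real K' := by
      rw [hv, div_mul_cancel₀ _ hV'.ne', ← hv]
      exact (mul_le_mul_of_nonneg_left h1 (by positivity)).trans cheb
    have : v * (38 * volume.real (K' ∩ {x | √(38 * v) < |inner ℝ x θ - m|})) ≤
        v * volume.real K' := by linarith
    have := le_of_mul_le_mul_left this hv0
    linarith
  have hdiff : volume.real (K \ K') = volume.real K - volume.real K' :=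
    measureReal_sdiff hsub hK'.measurableSet hKc.measure_ne_top
  have htot : 19 * volume.real (K ∩ {x | √(38 * v) < |inner ℝ x θ - m|}) ≤ volume.real K := by
    have hle : volume.real (K ∩ {x | √(38 * v) < |inner ℝ x θ - m|}) ≤
        volume.real (K' ∩ {x | √(38 * v) < |inner ℝ x θ - m|}) + volume.real (K \ K') := by
      refine (measureReal_mono (fun x hx => ?_) ?_).trans (measureReal_union_le _ _)
      · by_cases h : x ∈ K'
        · exact Or.inl ⟨h, hx.2⟩
        · exact Or.inr ⟨hx.1, h⟩
      · exact measure_ne_top_of_subset (Set.union_subset (Set.inter_subset_left.trans hsub)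
          Set.sdiff_subset) hKc.measure_ne_top
    have : volume.real K' ≤ volume.real K := measureReal_mono hsub hKc.measure_ne_top
    linarith
  have hY : 19 * volume (K ∩ {x | √(38 * v) < |inner ℝ x θ - m|}) ≤ volume K := by
    have ht : volume (K ∩ {x | √(38 * v) < |inner ℝ x θ - m|}) ≠ ⊤ :=
      measure_ne_top_of_subset Set.inter_subset_left hKc.measure_ne_top
    rw [← ENNReal.toReal_le_toReal (ENNReal.mul_ne_top (by simp) ht) hKc.measure_ne_top,
      ENNReal.toReal_mul]
    simpa [Measure.real] using htot
  have := hK.setIntegral_sq_le_of_volume_le hKc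
    (fun h => hK0.ne' (by simp [Measure.real, h])) θ m hr hY
  rw [hr2] at this
  rw [div_le_iff₀ hK0]
  linarith

end

/-! ### The logarithmic Laplace transform: gradient, Hessian and the gradient map. -/

section

open scoped ENNReal

/-- Differentiation under the integral, dominated on the unit ball around y. The weight g is
vector-valued so that g = 1 yields the gradient and g = id the Hessian. -/
theorem hasFDerivAt_setIntegral_exp_inner_smul {n : ℕ} {F : Type*} [NormedAddCommGroup F]
    [NormedSpace ℝ F] {K : Set (EuclideanSpace ℝ (Fin n))} (hK : IsCompact K)
    {g : EuclideanSpace ℝ (Fin n) → F} (hg : Continuous g) (y : EuclideanSpace ℝ (Fin n)) :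
    HasFDerivAt (fun y => ∫ x in K, Real.exp (inner ℝ x y) • g x)
      (∫ x in K, Real.exp (inner ℝ x y) • (innerSL ℝ x).smulRight (g x)) y := by
  have hc : ∀ y : EuclideanSpace ℝ (Fin n), Continuous fun x : EuclideanSpace ℝ (Fin n) =>
      Real.exp (inner ℝ x y) • g x := fun y => by fun_prop
  have hc' : Continuous fun x : EuclideanSpace ℝ (Fin n) =>
      Real.exp (inner ℝ x y) • (innerSL ℝ x).smulRight (g x) := by
    have : Continuous fun x : EuclideanSpace ℝ (Fin n) => (innerSL ℝ x).smulRight (g x) :=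
      (ContinuousLinearMap.smulRightL ℝ (EuclideanSpace ℝ (Fin n)) F).continuous₂.comp
        ((innerSL ℝ).continuous.prodMk hg)
    fun_prop
  refine hasFDerivAt_integral_of_dominated_of_fderiv_le
    (F := fun y x => Real.exp (inner ℝ x y) • g x)
    (F' := fun y x => Real.exp (inner ℝ x y) • (innerSL ℝ x).smulRight (g x))
    (bound := fun x => Real.exp (‖x‖ * (‖y‖ + 1)) * (‖x‖ * ‖g x‖))
    (Metric.ball_mem_nhds y one_pos) ?_ ?_ ?_ ?_ ?_ ?_
  · exact Filter.Eventually.of_forall fun z =>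
      ((hc z).continuousOn.integrableOn_compact hK).aestronglyMeasurable
  · exact (hc y).continuousOn.integrableOn_compact hK
  · exact (hc'.continuousOn.integrableOn_compact hK).aestronglyMeasurable
  · refine Filter.Eventually.of_forall fun x z hz => ?_
    rw [norm_smul, ContinuousLinearMap.norm_smulRight_apply, innerSL_apply_norm, Real.norm_eq_abs,
      Real.abs_exp]
    gcongr
    refine (real_inner_le_norm x z).trans ?_
    gcongr
    rw [Metric.mem_ball, dist_eq_norm] at hz
    have := norm_sub_norm_le z y
    linarith
  · exact (by fun_prop : Continuous fun x : EuclideanSpace ℝ (Fin n) =>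
      Real.exp (‖x‖ * (‖y‖ + 1)) * (‖x‖ * ‖g x‖)).continuousOn.integrableOn_compact hK
  · refine Filter.Eventually.of_forall fun x z _ => ?_
    have h1 : HasFDerivAt (fun z => inner ℝ x z) (innerSL ℝ x) z := (innerSL ℝ x).hasFDerivAt
    convert! h1.exp.smul_const (g x) using 1
    ext v
    simp [smul_smul]

namespace Slicing

variable {n : ℕ}

/-- The unnormalised Laplace transform of the uniform measure on `K`. -/
noncomputable def laplace (K : Set (EuclideanSpace ℝ (Fin n))) (y : EuclideanSpace ℝ (Fin n)) : ℝ :=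
  ∫ x in K, Real.exp (inner ℝ x y)

/-- The mean of the uniform measure on `K` tilted by `exp ⟨·, y⟩`. -/
noncomputable def tiltedMean (K : Set (EuclideanSpace ℝ (Fin n))) (y : EuclideanSpace ℝ (Fin n)) :
    EuclideanSpace ℝ (Fin n) :=
  (laplace K y)⁻¹ • ∫ x in K, Real.exp (inner ℝ x y) • x

/-- The covariance operator of the uniform measure on `K` tilted by `exp ⟨·, y⟩`. -/
noncomputable def tiltedCov (K : Set (EuclideanSpace ℝ (Fin n))) (y : EuclideanSpace ℝ (Fin n)) :
    EuclideanSpace ℝ (Fin n) →L[ℝ] EuclideanSpace ℝ (Fin n) :=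
  (laplace K y)⁻¹ • (∫ x in K, Real.exp (inner ℝ x y) • (innerSL ℝ x).smulRight x) -
    (innerSL ℝ (tiltedMean K y)).smulRight (tiltedMean K y)

section

variable {K : Set (EuclideanSpace ℝ (Fin n))}

theorem integrableOn_exp_smul {F : Type*} [NormedAddCommGroup F] [NormedSpace ℝ F]
    (hK : IsCompact K) (y : EuclideanSpace ℝ (Fin n)) {g : EuclideanSpace ℝ (Fin n) → F}
    (hg : Continuous g) : IntegrableOn (fun x => Real.exp (inner ℝ x y) • g x) K :=
  (by fun_prop : Continuous fun x : EuclideanSpace ℝ (Fin n) =>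
    Real.exp (inner ℝ x y) • g x).continuousOn.integrableOn_compact hK

theorem integrableOn_exp (hK : IsCompact K) (y : EuclideanSpace ℝ (Fin n)) :
    IntegrableOn (fun x => Real.exp (inner ℝ x y)) K :=
  (by fun_prop : Continuous fun x : EuclideanSpace ℝ (Fin n) =>
    Real.exp (inner ℝ x y)).continuousOn.integrableOn_compact hK

theorem laplace_pos (hK : IsCompact K) (hV : volume K ≠ 0) (y : EuclideanSpace ℝ (Fin n)) :
    0 < laplace K y := by
  have : NeZero (volume.restrict K) := ⟨by simpa [Measure.restrict_eq_zero] using hV⟩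
  exact integral_exp_pos (integrableOn_exp hK y)

theorem hasFDerivAt_laplace (hK : IsCompact K) (hV : volume K ≠ 0)
    (y : EuclideanSpace ℝ (Fin n)) :
    HasFDerivAt (laplace K) (laplace K y • innerSL ℝ (tiltedMean K y)) y := by
  have h := hasFDerivAt_setIntegral_exp_inner_smul hK (continuous_const (y := (1 : ℝ))) y
  simp only [smul_eq_mul, mul_one] at h
  have e : (∫ x in K, Real.exp (inner ℝ x y) • (innerSL ℝ x).smulRight (1 : ℝ)) =
      laplace K y • innerSL ℝ (tiltedMean K y) := by
    rw [tiltedMean, map_smul, smul_smul, mul_inv_cancel₀ (laplace_pos hK hV y).ne', one_smul,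
      ← ContinuousLinearMap.integral_comp_comm _ (integrableOn_exp_smul hK y continuous_id')]
    refine integral_congr_ae (Filter.Eventually.of_forall fun x => ?_)
    ext z
    simp
    rfl
  rw [e] at h
  exact h

theorem hasFDerivAt_h₁ (hK : IsCompact K) (hV : volume K ≠ 0) (y : EuclideanSpace ℝ (Fin n)) :
    HasFDerivAt (h₁ K) (innerSL ℝ (tiltedMean K y)) y := by
  have hvol : volume.real K ≠ 0 := by
    simp [Measure.real, ENNReal.toReal_eq_zero_iff, hV, hK.measure_ne_top]
  have e : h₁ K = fun y => Real.log (laplace K y / volume.real K) := by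
    ext y; rw [h₁, integral_div]; rfl
  have hpos := laplace_pos hK hV y
  have h := ((hasFDerivAt_laplace hK hV y).mul_const (volume.real K)⁻¹).log
    (mul_ne_zero hpos.ne' (inv_ne_zero hvol))
  rw [e]
  simp only [div_eq_mul_inv]
  convert! h using 1
  rw [smul_smul, smul_smul]
  have : (laplace K y * (volume.real K)⁻¹)⁻¹ * ((volume.real K)⁻¹ * laplace K y) = 1 := by
    field_simp
  rw [mul_assoc] at *
  rw [this, one_smul]

theorem hasFDerivAt_tiltedMean (hK : IsCompact K) (hV : volume K ≠ 0)
    (y : EuclideanSpace ℝ (Fin n)) : HasFDerivAt (tiltedMean K) (tiltedCov K y) y := by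
  have hpos := laplace_pos hK hV y
  have h1 := (hasDerivAt_inv hpos.ne').comp_hasFDerivAt y (hasFDerivAt_laplace hK hV y)
  have h2 := h1.smul (hasFDerivAt_setIntegral_exp_inner_smul hK continuous_id' y)
  convert! h2 using 1
  ext1 z
  simp only [tiltedCov, tiltedMean, sub_apply, smul_apply,
    add_apply, ContinuousLinearMap.smulRight_apply, Function.comp_apply,
    innerSL_apply_apply, smul_eq_mul, smul_smul, inner_smul_left, conj_trivial]
  rw [sub_eq_add_neg, ← neg_smul]
  congr 2
  field_simp

theorem fderiv_h₁ (hK : IsCompact K) (hV : volume K ≠ 0) :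
    fderiv ℝ (h₁ K) = fun y => innerSL ℝ (tiltedMean K y) :=
  funext fun y => (hasFDerivAt_h₁ hK hV y).fderiv

theorem hessian_h₁_apply (hK : IsCompact K) (hV : volume K ≠ 0) (y : EuclideanSpace ℝ (Fin n))
    (i j : Fin n) : hessian (h₁ K) y i j =
      inner ℝ (tiltedCov K y (EuclideanSpace.single i 1)) (EuclideanSpace.single j 1) := by
  have h := (innerSL ℝ).hasFDerivAt.comp y (hasFDerivAt_tiltedMean hK hV y)
  rw [hessian, Matrix.of_apply, fderiv_h₁ hK hV]
  erw [h.fderiv]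
  rfl

theorem det_hessian_h₁ (hK : IsCompact K) (hV : volume K ≠ 0) (y : EuclideanSpace ℝ (Fin n)) :
    (hessian (h₁ K) y).det = (tiltedCov K y).det := by
  rw [ContinuousLinearMap.det, ← LinearMap.det_toMatrix (EuclideanSpace.basisFun (Fin n) ℝ).toBasis,
    ← Matrix.det_transpose]
  congr 1
  ext i j
  rw [Matrix.transpose_apply, hessian_h₁_apply hK hV, LinearMap.toMatrix_apply]
  simp [EuclideanSpace.inner_single_right]

theorem inner_tiltedMean (hK : IsCompact K) (y v : EuclideanSpace ℝ (Fin n)) :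
    inner ℝ (tiltedMean K y) v =
      (laplace K y)⁻¹ * ∫ x in K, Real.exp (inner ℝ x y) * inner ℝ x v := by
  rw [tiltedMean, inner_smul_left, conj_trivial, real_inner_comm, ← integral_inner
    (integrableOn_exp_smul hK y continuous_id')]
  congr 1
  refine integral_congr_ae (Filter.Eventually.of_forall fun x => ?_)
  simp only [inner_smul_right, real_inner_comm]

theorem inner_tiltedCov (hK : IsCompact K) (y v w : EuclideanSpace ℝ (Fin n)) :
    inner ℝ (tiltedCov K y v) w =
      (laplace K y)⁻¹ * (∫ x in K, Real.exp (inner ℝ x y) * (inner ℝ x v * inner ℝ x w)) -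
        inner ℝ (tiltedMean K y) v * inner ℝ (tiltedMean K y) w := by
  have hc : Continuous fun x : EuclideanSpace ℝ (Fin n) => (innerSL ℝ x).smulRight x :=
    (ContinuousLinearMap.smulRightL ℝ (EuclideanSpace ℝ (Fin n)) _).continuous₂.comp
      ((innerSL ℝ).continuous.prodMk continuous_id')
  have h1 := integrableOn_exp_smul hK y hc
  rw [tiltedCov, sub_apply, inner_sub_left, smul_apply,
    inner_smul_left, conj_trivial, ContinuousLinearMap.smulRight_apply, inner_smul_left,
    ContinuousLinearMap.integral_apply h1, real_inner_comm, ← integral_inner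
      (h1.apply_continuousLinearMap v)]
  congr 2
  refine integral_congr_ae (Filter.Eventually.of_forall fun x => ?_)
  simp only [smul_apply, ContinuousLinearMap.smulRight_apply, inner_smul_right,
    innerSL_apply_apply, real_inner_comm]

theorem volume_setOf_inner_eq {v : EuclideanSpace ℝ (Fin n)} (hv : v ≠ 0) (c : ℝ) :
    volume {x : EuclideanSpace ℝ (Fin n) | inner ℝ x v = c} = 0 := by
  rcases Set.eq_empty_or_nonempty {x : EuclideanSpace ℝ (Fin n) | inner ℝ x v = c} with h | ⟨x₀, h₀⟩
  · rw [h, measure_empty]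
  · have e : {x : EuclideanSpace ℝ (Fin n) | inner ℝ x v = c} =
        (fun x => -x₀ + x) ⁻¹' (LinearMap.ker (innerSL ℝ v).toLinearMap : Set _) := by
      ext x
      simp only [Set.mem_ofPred_eq, Set.mem_preimage, SetLike.mem_coe, LinearMap.mem_ker,
        ContinuousLinearMap.coe_coe, innerSL_apply_apply, inner_add_right, inner_neg_right] at h₀ ⊢
      rw [real_inner_comm v x, real_inner_comm v x₀] at *
      constructor <;> intro h <;> linarith
    rw [e, measure_preimage_add]
    refine Measure.addHaar_submodule _ _ fun htop => hv ?_
    have : v ∈ LinearMap.ker (innerSL ℝ v).toLinearMap := htop ▸ Submodule.mem_top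
    simpa using this

theorem setIntegral_mul_inner_sub_sq_pos (hK : IsCompact K) (hV : volume K ≠ 0)
    {w : EuclideanSpace ℝ (Fin n) → ℝ} (hw : Continuous w) (hw0 : ∀ x, 0 < w x)
    {v : EuclideanSpace ℝ (Fin n)} (hv : v ≠ 0) (c : ℝ) :
    0 < ∫ x in K, w x * (inner ℝ x v - c) ^ 2 := by
  have hc : Continuous fun x : EuclideanSpace ℝ (Fin n) => w x * (inner ℝ x v - c) ^ 2 := by
    fun_prop
  rw [setIntegral_pos_iff_support_of_nonneg_ae
    (Filter.Eventually.of_forall fun x => mul_nonneg (hw0 x).le (sq_nonneg _))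
    (hc.continuousOn.integrableOn_compact hK)]
  have e : Function.support (fun x : EuclideanSpace ℝ (Fin n) => w x * (inner ℝ x v - c) ^ 2) ∩ K =
      K \ {x | inner ℝ x v = c} := by
    ext x
    simp [(hw0 x).ne', sub_eq_zero, and_comm]
  rw [e, measure_sdiff_null (volume_setOf_inner_eq hv c)]
  exact pos_iff_ne_zero.2 hV

/-- The quadratic form of the tilted covariance is a variance; this form makes positive definiteness
visible. -/
theorem inner_tiltedCov_self (hK : IsCompact K) (hV : volume K ≠ 0)
    (y v : EuclideanSpace ℝ (Fin n)) : inner ℝ (tiltedCov K y v) v = (laplace K y)⁻¹ *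
      ∫ x in K, Real.exp (inner ℝ x y) * (inner ℝ x v - inner ℝ (tiltedMean K y) v) ^ 2 := by
  have hZ := (laplace_pos hK hV y).ne'
  set c := inner ℝ (tiltedMean K y) v with hc
  have i1 : IntegrableOn (fun x : EuclideanSpace ℝ (Fin n) =>
      Real.exp (inner ℝ x y) * (inner ℝ x v * inner ℝ x v)) K :=
    integrableOn_exp_smul hK y (by fun_prop)
  have i2 : IntegrableOn (fun x : EuclideanSpace ℝ (Fin n) =>
      Real.exp (inner ℝ x y) * inner ℝ x v) K := integrableOn_exp_smul hK y (by fun_prop)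
  have e : (fun x : EuclideanSpace ℝ (Fin n) => Real.exp (inner ℝ x y) * (inner ℝ x v - c) ^ 2) =
      fun x => (Real.exp (inner ℝ x y) * (inner ℝ x v * inner ℝ x v) -
        2 * c * (Real.exp (inner ℝ x y) * inner ℝ x v)) + c ^ 2 * Real.exp (inner ℝ x y) := by
    ext x; ring
  rw [inner_tiltedCov hK, e, integral_add (by exact i1.sub (i2.const_mul _))
    (by exact (integrableOn_exp hK y).const_mul _), integral_sub i1 (i2.const_mul _), integral_const_mul,
    integral_const_mul]
  have h1 : ∫ x in K, Real.exp (inner ℝ x y) * inner ℝ x v = laplace K y * c := by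
    rw [hc, inner_tiltedMean hK]; field_simp
  rw [h1, ← hc]
  change _ = (laplace K y)⁻¹ * (_ + c ^ 2 * laplace K y)
  field_simp
  ring

theorem inner_tiltedCov_self_pos (hK : IsCompact K) (hV : volume K ≠ 0)
    (y : EuclideanSpace ℝ (Fin n)) {v : EuclideanSpace ℝ (Fin n)} (hv : v ≠ 0) :
    0 < inner ℝ (tiltedCov K y v) v := by
  rw [inner_tiltedCov_self hK hV]
  exact mul_pos (inv_pos.2 (laplace_pos hK hV y))
    (setIntegral_mul_inner_sub_sq_pos hK hV (by fun_prop) (fun x => Real.exp_pos _) hv _)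

/-- Along the segment from z to y, the component of the gradient in direction y - z has derivative
equal to the positive quadratic form of the Hessian, so it is strictly increasing. -/
theorem tiltedMean_injective (hK : IsCompact K) (hV : volume K ≠ 0) :
    Function.Injective (tiltedMean K) := by
  intro y z hyz
  by_contra hne
  have hv : y - z ≠ 0 := sub_ne_zero.2 hne
  have hd : ∀ t : ℝ, HasDerivAt (fun t : ℝ => inner ℝ (y - z) (tiltedMean K (z + t • (y - z))))
      (inner ℝ (y - z) (tiltedCov K (z + t • (y - z)) (y - z))) t := by
    intro t
    have h1 : HasDerivAt (fun t : ℝ => z + t • (y - z)) (y - z) t := by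
      simpa using ((hasDerivAt_id t).smul_const (y - z)).const_add z
    have h2 := (hasFDerivAt_tiltedMean hK hV (z + t • (y - z))).comp_hasDerivAt t h1
    exact ((innerSL ℝ (y - z)).hasFDerivAt.comp_hasDerivAt t h2)
  have hmono := strictMono_of_hasDerivAt_pos hd fun t => by
    rw [real_inner_comm]; exact inner_tiltedCov_self_pos hK hV _ hv
  have := hmono zero_lt_one
  simp [hyz] at this

/-- It is the barycentre of a probability measure concentrated on the closed convex set K. -/
theorem tiltedMean_mem (hK : IsCompact K) (hconv : Convex ℝ K) (hV : volume K ≠ 0)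
    (y : EuclideanSpace ℝ (Fin n)) : tiltedMean K y ∈ K := by
  have : NeZero (volume.restrict K) := ⟨by simpa [Measure.restrict_eq_zero] using hV⟩
  have := isProbabilityMeasure_tilted (integrableOn_exp hK y)
  have hae : ∀ᵐ x ∂((volume.restrict K).tilted fun x => inner ℝ x y), x ∈ K :=
    (tilted_absolutelyContinuous _ _).ae_le (ae_restrict_mem hK.measurableSet)
  have e : tiltedMean K y = ∫ x, x ∂((volume.restrict K).tilted fun x => inner ℝ x y) := by
    rw [integral_tilted, tiltedMean, ← integral_smul]
    refine integral_congr_ae (Filter.Eventually.of_forall fun x => ?_)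
    simp only [smul_smul]
    congr 1
    rw [div_eq_inv_mul]; rfl
  rw [e]
  refine hconv.integral_mem hK.isClosed hae ?_
  obtain ⟨C, hC⟩ := hK.isBounded.exists_norm_le
  exact Integrable.of_bound (by fun_prop) C (hae.mono fun x hx => hC x hx)

end

end Slicing

end

/-! ### Symmetric operators, and the volume bound from convexity of u. -/

section

open scoped ENNReal

section SymmetricOperators

variable {n : ℕ} {A : EuclideanSpace ℝ (Fin n) →L[ℝ] EuclideanSpace ℝ (Fin n)}

theorem LinearMap.IsSymmetric.exists_orthonormalBasis_eigenvalues
    (hA : (A : EuclideanSpace ℝ (Fin n) →ₗ[ℝ] EuclideanSpace ℝ (Fin n)).IsSymmetric) :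
    ∃ (b : OrthonormalBasis (Fin n) ℝ (EuclideanSpace ℝ (Fin n))) (l : Fin n → ℝ),
      (∀ i, A (b i) = l i • b i) ∧ (∀ i, l i = inner ℝ (A (b i)) (b i)) ∧ A.det = ∏ i, l i := by
  have hn : Module.finrank ℝ (EuclideanSpace ℝ (Fin n)) = n := by simp
  have h1 : ∀ i, A (hA.eigenvectorBasis hn i) =
      hA.eigenvalues hn i • hA.eigenvectorBasis hn i := fun i => hA.apply_eigenvectorBasis hn i
  refine ⟨hA.eigenvectorBasis hn, hA.eigenvalues hn, h1, fun i => ?_, ?_⟩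
  · rw [h1, inner_smul_left, real_inner_self_eq_norm_sq,
      (hA.eigenvectorBasis hn).orthonormal.1]
    simp
  · exact hA.det_eq_prod_eigenvalues hn

theorem LinearMap.IsSymmetric.pow_le_det
    (hA : (A : EuclideanSpace ℝ (Fin n) →ₗ[ℝ] EuclideanSpace ℝ (Fin n)).IsSymmetric) {c : ℝ}
    (hc : 0 ≤ c) (h : ∀ v, c * ‖v‖ ^ 2 ≤ inner ℝ (A v) v) : c ^ n ≤ A.det := by
  obtain ⟨b, l, -, hl, hdet⟩ := hA.exists_orthonormalBasis_eigenvalues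
  rw [hdet]
  calc c ^ n = ∏ _i : Fin n, c := by simp
    _ ≤ ∏ i, l i := Finset.prod_le_prod (fun _ _ => hc) fun i _ => by
      rw [hl]
      have := h (b i)
      rwa [b.orthonormal.1, one_pow, mul_one] at this

theorem LinearMap.IsSymmetric.det_pos_of_inner_pos
    (hA : (A : EuclideanSpace ℝ (Fin n) →ₗ[ℝ] EuclideanSpace ℝ (Fin n)).IsSymmetric)
    (h : ∀ v, v ≠ 0 → 0 < inner ℝ (A v) v) : 0 < A.det := by
  obtain ⟨b, l, -, hl, hdet⟩ := hA.exists_orthonormalBasis_eigenvalues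
  rw [hdet]
  exact Finset.prod_pos fun i _ => hl i ▸ h _ (b.orthonormal.ne_zero i)

/-- A positive definite operator has an invertible symmetric square root. -/
theorem LinearMap.IsSymmetric.exists_sqrt
    (hA : (A : EuclideanSpace ℝ (Fin n) →ₗ[ℝ] EuclideanSpace ℝ (Fin n)).IsSymmetric)
    (h : ∀ v, v ≠ 0 → 0 < inner ℝ (A v) v) :
    ∃ S : EuclideanSpace ℝ (Fin n) ≃L[ℝ] EuclideanSpace ℝ (Fin n),
      (∀ v w, inner ℝ (S v) w = inner ℝ v (S w)) ∧ ∀ v, S (S v) = A v := by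
  obtain ⟨b, l, hbl, hl, -⟩ := hA.exists_orthonormalBasis_eigenvalues
  have hpos : ∀ i, 0 < l i := fun i => hl i ▸ h _ (b.orthonormal.ne_zero i)
  set S : EuclideanSpace ℝ (Fin n) →ₗ[ℝ] EuclideanSpace ℝ (Fin n) :=
    b.toBasis.constr ℝ (fun i => √(l i) • b i) with hS
  have hSb : ∀ i, S (b i) = √(l i) • b i := fun i => by
    have := b.toBasis.constr_basis ℝ (fun i => √(l i) • b i) i
    rwa [b.coe_toBasis] at this
  have hSS : ∀ v, S (S v) = A v := by
    have : S ∘ₗ S = A := b.toBasis.ext fun i => by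
      simp [hSb, hbl, smul_smul, Real.mul_self_sqrt (hpos i).le]
    exact fun v => LinearMap.congr_fun this v
  have hinner : ∀ v w, inner ℝ (S v) w = inner ℝ v (S w) := by
    intro v w
    have hv : ∀ i, inner ℝ (S v) (b i) = inner ℝ v (S (b i)) := by
      intro i
      rw [hSb, inner_smul_right]
      conv_lhs => rw [← b.sum_repr v]
      conv_rhs => rw [← b.sum_repr v]
      simp only [map_sum, map_smul, hSb, sum_inner, inner_smul_left, conj_trivial,
        b.inner_eq_ite]
      simp [mul_comm]
    rw [← b.sum_repr w]
    simp only [map_sum, map_smul, inner_sum, inner_smul_right, hv]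
  have hinj : Function.Injective S := by
    rw [← LinearMap.ker_eq_bot, LinearMap.ker_eq_bot']
    intro v hv
    by_contra hne
    have := h v hne
    rw [← hSS, hv, map_zero, inner_zero_left] at this
    exact lt_irrefl _ this
  refine ⟨(LinearEquiv.ofInjectiveEndo S hinj).toContinuousLinearEquiv, hinner, hSS⟩

end SymmetricOperators

namespace Slicing

variable {n : ℕ} {K : Set (EuclideanSpace ℝ (Fin n))}

theorem isSymmetric_tiltedCov (hK : IsCompact K) (y : EuclideanSpace ℝ (Fin n)) :
    (tiltedCov K y : EuclideanSpace ℝ (Fin n) →ₗ[ℝ] EuclideanSpace ℝ (Fin n)).IsSymmetric := by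
  intro v w
  rw [ContinuousLinearMap.coe_coe, real_inner_comm _ v, inner_tiltedCov hK, inner_tiltedCov hK]
  simp only [mul_comm (inner ℝ _ v) (inner ℝ _ w)]

theorem det_tiltedCov_pos (hK : IsCompact K) (hV : volume K ≠ 0)
    (y : EuclideanSpace ℝ (Fin n)) : 0 < (tiltedCov K y).det :=
  (isSymmetric_tiltedCov hK y).det_pos_of_inner_pos fun _ hv => inner_tiltedCov_self_pos hK hV y hv

theorem laplace_zero : laplace K 0 = volume.real K := by
  simp [laplace]

theorem h₁_zero (hK : IsCompact K) (hV : volume K ≠ 0) : h₁ K 0 = 0 := by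
  have hvol : volume.real K ≠ 0 := by
    simp [Measure.real, ENNReal.toReal_eq_zero_iff, hV, hK.measure_ne_top]
  simp [h₁, hvol]

theorem det_tiltedCov_eq_exp (hK : IsCompact K) (hV : volume K ≠ 0) (B : ℝ)
    (y : EuclideanSpace ℝ (Fin n)) :
    (tiltedCov K y).det = Real.exp (u B K y - B * h₁ K y) := by
  rw [u, add_sub_cancel_right, det_hessian_h₁ hK hV, Real.exp_log (det_tiltedCov_pos hK hV y)]

theorem measurable_det_tiltedCov (hK : IsCompact K) (hV : volume K ≠ 0) :
    Measurable fun y => (tiltedCov K y).det := by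
  have : tiltedCov K = fderiv ℝ (tiltedMean K) :=
    funext fun y => (hasFDerivAt_tiltedMean hK hV y).fderiv.symm
  rw [this]
  exact ContinuousLinearMap.continuous_det.measurable.comp (measurable_fderiv ℝ _)

/-- Change of variables along `∇ h₁`, which maps `ℝⁿ` injectively into `K`. -/
theorem setLIntegral_det_tiltedCov_le (hK : IsCompact K) (hconv : Convex ℝ K) (hV : volume K ≠ 0)
    {Q : Set (EuclideanSpace ℝ (Fin n))} (hQ : MeasurableSet Q) :
    ∫⁻ y in Q, ENNReal.ofReal (tiltedCov K y).det ≤ volume K := by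
  have h := lintegral_abs_det_fderiv_eq_addHaar_image volume hQ
    (fun y _ => (hasFDerivAt_tiltedMean hK hV y).hasFDerivWithinAt)
    (tiltedMean_injective hK hV).injOn
  simp only [abs_of_pos (det_tiltedCov_pos hK hV _)] at h
  rw [h]
  exact measure_mono (Set.image_subset_iff.2 fun y _ => tiltedMean_mem hK hconv hV y)

/-- The volume of `K` is bounded below through the convexity of `u B K` on a symmetric region on
which the even part of `h₁ K` is bounded. -/
theorem volume_mul_exp_mul_det_le {B D : ℝ} (hB : 0 ≤ B) (hK : IsCompact K) (hconv : Convex ℝ K)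
    (hV : volume K ≠ 0) (hu : ConvexityHypothesis B K) {Q : Set (EuclideanSpace ℝ (Fin n))}
    (hQ : MeasurableSet Q) (hsymm : -Q = Q)
    (hD : ∀ y ∈ Q, h₁ K y + h₁ K (-y) ≤ 2 * D) :
    volume.real Q * (Real.exp (-(B * D)) * (tiltedCov K 0).det) ≤ volume.real K := by
  set φ : EuclideanSpace ℝ (Fin n) → ℝ≥0∞ := fun y => ENNReal.ofReal (tiltedCov K y).det with hφ
  have hφm : Measurable φ := (measurable_det_tiltedCov hK hV).ennreal_ofReal
  set a := Real.exp (-(B * D)) * (tiltedCov K 0).det with ha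
  have hneg : ∫⁻ y in Q, φ (-y) = ∫⁻ y in Q, φ y := by
    have := (Measure.measurePreserving_neg
      (volume : Measure (EuclideanSpace ℝ (Fin n)))).setLIntegral_comp_preimage hQ hφm
    rwa [Set.neg_preimage, hsymm] at this
  have hpt : ∀ y ∈ Q, ENNReal.ofReal (2 * a) ≤ φ y + φ (-y) := by
    intro y hy
    rw [hφ]
    simp only
    rw [← ENNReal.ofReal_add (det_tiltedCov_pos hK hV _).le (det_tiltedCov_pos hK hV _).le]
    refine ENNReal.ofReal_le_ofReal ?_
    -- Convexity at 0 = (y + (-y))/2, where h₁ vanishes, bounds the mean of log det ∇²h₁ at ±y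
    -- below; AM–GM on the exponentials then bounds the sum of the determinants.
    have hmid := hu.2 (Set.mem_univ y) (Set.mem_univ (-y))
      (by norm_num : (0 : ℝ) ≤ 1 / 2) (by norm_num : (0 : ℝ) ≤ 1 / 2) (by norm_num)
    rw [smul_neg, add_neg_cancel, smul_eq_mul, smul_eq_mul] at hmid
    have hDy := mul_le_mul_of_nonneg_left (hD y hy) hB
    rw [ha, det_tiltedCov_eq_exp hK hV B, det_tiltedCov_eq_exp hK hV B y,
      det_tiltedCov_eq_exp hK hV B (-y), h₁_zero hK hV, ← Real.exp_add]
    set p := u B K y - B * h₁ K y with hp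
    set q := u B K (-y) - B * h₁ K (-y) with hq
    have h1 : -(B * D) + (u B K 0 - B * 0) ≤ p / 2 + q / 2 := by rw [hp, hq]; linarith
    have h2 : Real.exp p = Real.exp (p / 2) ^ 2 := by rw [← Real.exp_nat_mul]; congr 1; push_cast; ring
    have h3 : Real.exp q = Real.exp (q / 2) ^ 2 := by rw [← Real.exp_nat_mul]; congr 1; push_cast; ring
    have h4 := Real.exp_le_exp.2 h1
    rw [Real.exp_add (p / 2)] at h4
    rw [h2, h3]
    nlinarith [sq_nonneg (Real.exp (p / 2) - Real.exp (q / 2))]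
  have h1 : ENNReal.ofReal (2 * a) * volume Q ≤ 2 * volume K := by
    calc ENNReal.ofReal (2 * a) * volume Q = ∫⁻ _ in Q, ENNReal.ofReal (2 * a) := by simp
      _ ≤ ∫⁻ y in Q, (φ y + φ (-y)) := setLIntegral_mono' hQ hpt
      _ = (∫⁻ y in Q, φ y) + ∫⁻ y in Q, φ y := by rw [lintegral_add_left hφm, hneg]
      _ ≤ 2 * volume K := by
        rw [two_mul]
        exact add_le_add (setLIntegral_det_tiltedCov_le hK hconv hV hQ)
          (setLIntegral_det_tiltedCov_le hK hconv hV hQ)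
  have ha0 : 0 < a := mul_pos (Real.exp_pos _) (det_tiltedCov_pos hK hV 0)
  have h2 := ENNReal.toReal_mono (ENNReal.mul_ne_top (by simp) hK.measure_ne_top) h1
  rw [ENNReal.toReal_mul, ENNReal.toReal_mul, ENNReal.toReal_ofReal (by positivity)] at h2
  simp only [ENNReal.toReal_ofNat] at h2
  change 2 * a * volume.real Q ≤ 2 * volume.real K at h2
  linarith

theorem cov_apply (hK : IsCompact K) (i j : Fin n) : cov K i j =
    inner ℝ (tiltedCov K 0 (EuclideanSpace.single i 1)) (EuclideanSpace.single j 1) := by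
  rw [inner_tiltedCov hK, inner_tiltedMean hK, inner_tiltedMean hK, laplace_zero, cov]
  simp [div_eq_inv_mul, EuclideanSpace.inner_single_right, integral_const_mul]

theorem det_cov (hK : IsCompact K) : (cov K).det = (tiltedCov K 0).det := by
  rw [ContinuousLinearMap.det, ← LinearMap.det_toMatrix (EuclideanSpace.basisFun (Fin n) ℝ).toBasis,
    ← Matrix.det_transpose]
  congr 1
  ext i j
  rw [Matrix.transpose_apply, cov_apply hK, LinearMap.toMatrix_apply]
  simp [EuclideanSpace.inner_single_right]

theorem inner_tiltedCov_zero_self (hK : IsCompact K) (hV : volume K ≠ 0)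
    (v : EuclideanSpace ℝ (Fin n)) : inner ℝ (tiltedCov K 0 v) v =
      (∫ x in K, (inner ℝ x v - inner ℝ (tiltedMean K 0) v) ^ 2) / volume.real K := by
  rw [inner_tiltedCov_self hK hV, laplace_zero, div_eq_inv_mul]
  simp

/-- The mean minimises the second moment about a point. This permits centring the functional on K at
the barycentre of the subset K'. -/
theorem inner_tiltedCov_zero_self_le (hK : IsCompact K) (hV : volume K ≠ 0)
    (v : EuclideanSpace ℝ (Fin n)) (m : ℝ) : inner ℝ (tiltedCov K 0 v) v ≤
      (∫ x in K, (inner ℝ x v - m) ^ 2) / volume.real K := by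
  have hvol : volume.real K ≠ 0 := by
    simp [Measure.real, ENNReal.toReal_eq_zero_iff, hV, hK.measure_ne_top]
  have hpos : 0 < volume.real K := lt_of_le_of_ne measureReal_nonneg hvol.symm
  have i2 : IntegrableOn (fun x : EuclideanSpace ℝ (Fin n) => inner ℝ x v) K :=
    (by fun_prop : Continuous fun x : EuclideanSpace ℝ (Fin n) =>
      inner ℝ x v).continuousOn.integrableOn_compact hK
  have i1 : ∀ c : ℝ, IntegrableOn (fun x : EuclideanSpace ℝ (Fin n) => (inner ℝ x v - c) ^ 2) K :=
    fun c => (by fun_prop : Continuous fun x : EuclideanSpace ℝ (Fin n) =>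
      (inner ℝ x v - c) ^ 2).continuousOn.integrableOn_compact hK
  have i3 : ∀ c : ℝ, IntegrableOn (fun _ : EuclideanSpace ℝ (Fin n) => c) K := fun c =>
    continuous_const.continuousOn.integrableOn_compact hK
  have hmean : ∫ x in K, inner ℝ x v = volume.real K * inner ℝ (tiltedMean K 0) v := by
    rw [inner_tiltedMean hK, laplace_zero]
    simp [hvol]
  rw [inner_tiltedCov_zero_self hK hV]
  set c := inner ℝ (tiltedMean K 0) v with hc
  have e : (fun x : EuclideanSpace ℝ (Fin n) => (inner ℝ x v - m) ^ 2) =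
      fun x => ((inner ℝ x v - c) ^ 2 + 2 * (c - m) * inner ℝ x v) + (m ^ 2 - c ^ 2) := by
    ext x; ring
  rw [e, integral_add (by exact (i1 c).add (i2.const_mul _)) (i3 _),
    integral_add (i1 c) (i2.const_mul _), integral_const_mul, hmean, setIntegral_const, smul_eq_mul]
  gcongr
  nlinarith [mul_nonneg hpos.le (sq_nonneg (c - m))]

theorem h₁_le_of_inner_le (hK : IsCompact K) (hV : volume K ≠ 0) (y : EuclideanSpace ℝ (Fin n))
    {a : ℝ} (h : ∀ x ∈ K, inner ℝ x y ≤ a) : h₁ K y ≤ a := by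
  have hvol : volume.real K ≠ 0 := by
    simp [Measure.real, ENNReal.toReal_eq_zero_iff, hV, hK.measure_ne_top]
  have hpos : 0 < volume.real K := lt_of_le_of_ne measureReal_nonneg hvol.symm
  have hle : laplace K y ≤ volume.real K * Real.exp a := by
    rw [← smul_eq_mul, ← setIntegral_const]
    exact setIntegral_mono_on (integrableOn_exp hK y)
      (continuous_const.continuousOn.integrableOn_compact hK) hK.measurableSet
      fun x hx => Real.exp_le_exp.2 (h x hx)
  rw [h₁, integral_div]
  change Real.log (laplace K y / volume.real K) ≤ a
  rw [Real.log_le_iff_le_exp (div_pos (laplace_pos hK hV y) hpos),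
    div_le_iff₀' hpos]
  exact hle

end Slicing

/-- The ball contains the unit cube [0,1]ⁿ. -/
theorem EuclideanSpace.one_le_volume_closedBall_sqrt (n : ℕ) :
    1 ≤ volume.real (Metric.closedBall (0 : EuclideanSpace ℝ (Fin n)) √n) := by
  have mp := PiLp.volume_preserving_ofLp (Fin n)
  have hsub : WithLp.ofLp ⁻¹' (Set.Icc (0 : Fin n → ℝ) 1) ⊆
      Metric.closedBall (0 : EuclideanSpace ℝ (Fin n)) √n := by
    intro x hx
    rw [mem_closedBall_zero_iff, EuclideanSpace.norm_eq]
    refine Real.sqrt_le_sqrt ?_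
    calc ∑ i, ‖x i‖ ^ 2 ≤ ∑ _i : Fin n, (1 : ℝ) := Finset.sum_le_sum fun i _ => by
          have h0 : 0 ≤ x i := hx.1 i
          have h1 : x i ≤ 1 := hx.2 i
          rw [Real.norm_eq_abs, sq_abs]; nlinarith
      _ = n := by simp
  have h1 : volume (WithLp.ofLp ⁻¹' (Set.Icc (0 : Fin n → ℝ) 1) : Set (EuclideanSpace ℝ (Fin n))) =
      1 := by
    rw [mp.measure_preimage measurableSet_Icc.nullMeasurableSet, Real.volume_Icc_pi]
    simp
  have := measureReal_mono (μ := volume) hsub (isCompact_closedBall _ _).measure_ne_top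
  simpa [Measure.real, h1] using this

end

/-! ### Truncation to an ellipsoid and the slicing bound. -/

section

open scoped ENNReal

namespace Slicing

variable {n : ℕ} {K : Set (EuclideanSpace ℝ (Fin n))}

/-- After whitening by S⁻¹ each coordinate has variance 1, and the n coordinates add up. -/
theorem setIntegral_norm_sq_eq (hK : IsCompact K) (hV : volume K ≠ 0)
    {S : EuclideanSpace ℝ (Fin n) ≃L[ℝ] EuclideanSpace ℝ (Fin n)}
    (hS : ∀ v w, inner ℝ (S v) w = inner ℝ v (S w)) (hSS : ∀ v, S (S v) = tiltedCov K 0 v) :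
    ∫ x in K, ‖S.symm (x - tiltedMean K 0)‖ ^ 2 = n * volume.real K := by
  have hvol : volume.real K ≠ 0 := by
    simp [Measure.real, ENNReal.toReal_eq_zero_iff, hV, hK.measure_ne_top]
  set θ : Fin n → EuclideanSpace ℝ (Fin n) := fun i => S.symm (EuclideanSpace.basisFun (Fin n) ℝ i)
  have hθ : ∀ i x, inner ℝ (EuclideanSpace.basisFun (Fin n) ℝ i) (S.symm x) = inner ℝ x (θ i) := by
    intro i x
    have h1 := hS (θ i) (S.symm x)
    rw [S.apply_symm_apply, S.apply_symm_apply] at h1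
    rw [h1, real_inner_comm]
  have h1 : ∀ x, ‖S.symm (x - tiltedMean K 0)‖ ^ 2 =
      ∑ i, (inner ℝ x (θ i) - inner ℝ (tiltedMean K 0) (θ i)) ^ 2 := by
    intro x
    rw [← (EuclideanSpace.basisFun (Fin n) ℝ).sum_sq_norm_inner_right]
    refine Finset.sum_congr rfl fun i _ => ?_
    rw [hθ, inner_sub_left, Real.norm_eq_abs, sq_abs]
  simp only [h1]
  rw [integral_finsetSum _ fun i _ => (by fun_prop : Continuous fun x : EuclideanSpace ℝ (Fin n) =>
      (inner ℝ x (θ i) - inner ℝ (tiltedMean K 0) (θ i)) ^ 2).continuousOn.integrableOn_compact hK]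
  have h2 : ∀ i, ∫ x in K, (inner ℝ x (θ i) - inner ℝ (tiltedMean K 0) (θ i)) ^ 2 =
      volume.real K := by
    intro i
    have h3 := inner_tiltedCov_zero_self hK hV (θ i)
    rw [← hSS, hS, S.apply_symm_apply, real_inner_self_eq_norm_sq,
      (EuclideanSpace.basisFun (Fin n) ℝ).orthonormal.1, one_pow, eq_div_iff hvol, one_mul] at h3
    exact h3.symm
  simp [h2]

/-- Chebyshev for the whitened norm: its mean square is n, so the part beyond 7√n has proportion at
most 1/49, within the 1/38 that the second-moment comparison allows. -/
theorem mul_volume_le_of_truncation (hK : IsCompact K) (hV : volume K ≠ 0) (hn : 1 ≤ n)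
    {S : EuclideanSpace ℝ (Fin n) ≃L[ℝ] EuclideanSpace ℝ (Fin n)}
    (hS : ∀ v w, inner ℝ (S v) w = inner ℝ v (S w)) (hSS : ∀ v, S (S v) = tiltedCov K 0 v) :
    37 * volume.real K ≤
      38 * volume.real (K ∩ {x | ‖S.symm (x - tiltedMean K 0)‖ ≤ 7 * √n}) := by
  have hn0 : (0 : ℝ) < n := by exact_mod_cast hn
  set T := {x | ‖S.symm (x - tiltedMean K 0)‖ ≤ 7 * √(n : ℝ)}
  have hTc : IsClosed T := isClosed_le (by fun_prop) continuous_const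
  have hc : Continuous fun x => ‖S.symm (x - tiltedMean K 0)‖ ^ 2 := by fun_prop
  have cheb := mul_meas_ge_le_integral_of_nonneg (μ := volume.restrict K)
    (f := fun x => ‖S.symm (x - tiltedMean K 0)‖ ^ 2)
    (Filter.Eventually.of_forall fun x => sq_nonneg _)
    (hc.continuousOn.integrableOn_compact hK) (49 * n)
  rw [setIntegral_norm_sq_eq hK hV hS hSS] at cheb
  have h1 : volume.real (K \ T) ≤
      (volume.restrict K).real {x | 49 * (n : ℝ) ≤ ‖S.symm (x - tiltedMean K 0)‖ ^ 2} := by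
    have : IsFiniteMeasure (volume.restrict K) :=
      ⟨by rw [Measure.restrict_apply_univ]; exact hK.measure_lt_top⟩
    rw [Set.sdiff_eq, Set.inter_comm, ← measureReal_restrict_apply hTc.measurableSet.compl]
    refine measureReal_mono fun x hx => ?_
    simp only [T, Set.mem_compl_iff, Set.mem_ofPred_eq, not_le] at hx ⊢
    calc 49 * (n : ℝ) = (7 * √n) ^ 2 := by rw [mul_pow, Real.sq_sqrt hn0.le]; norm_num
      _ ≤ _ := pow_le_pow_left₀ (by positivity) hx.le 2
  have h2 : n * (49 * volume.real (K \ T)) ≤ n * volume.real K := by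
    refine le_trans ?_ cheb
    rw [mul_left_comm, ← mul_assoc]
    gcongr
  have h3 := le_of_mul_le_mul_left h2 hn0
  have h4 := measureReal_inter_add_sdiff (μ := volume) (s := K) hTc.measurableSet hK.measure_ne_top
  have h5 : 0 ≤ volume.real (K \ T) := measureReal_nonneg
  linarith

/-- The second-moment comparison in every direction says Cov(K) ≤ 684 Cov(K') as quadratic forms.
Conjugating by S⁻¹ turns Cov(K) into the identity, so every eigenvalue of the conjugated Cov(K') is
at least 1/684. -/
theorem det_tiltedCov_le_of_subset {K' : Set (EuclideanSpace ℝ (Fin n))} (hK : IsCompact K)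
    (hconv : Convex ℝ K) (hV : volume K ≠ 0) (hK' : IsCompact K') (hsub : K' ⊆ K)
    (hV' : volume K' ≠ 0) (hvol : 37 * volume.real K ≤ 38 * volume.real K')
    {S : EuclideanSpace ℝ (Fin n) ≃L[ℝ] EuclideanSpace ℝ (Fin n)}
    (hS : ∀ v w, inner ℝ (S v) w = inner ℝ v (S w)) (hSS : ∀ v, S (S v) = tiltedCov K 0 v) :
    (684⁻¹ : ℝ) ^ n * (S : EuclideanSpace ℝ (Fin n) →L[ℝ] EuclideanSpace ℝ (Fin n)).det ^ 2 ≤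
      (tiltedCov K' 0).det := by
  have hpos : 0 < volume.real K :=
    ENNReal.toReal_pos hV hK.measure_ne_top
  set R : EuclideanSpace ℝ (Fin n) →L[ℝ] EuclideanSpace ℝ (Fin n) :=
    (S.symm : EuclideanSpace ℝ (Fin n) →L[ℝ] EuclideanSpace ℝ (Fin n)) with hR
  have hRsymm : ∀ v w, inner ℝ (R v) w = inner ℝ v (R w) := fun v w => by
    have := hS (S.symm v) (S.symm w)
    rw [S.apply_symm_apply, S.apply_symm_apply] at this
    exact this.symm
  have hsym : ((R ∘L tiltedCov K' 0 ∘L R : EuclideanSpace ℝ (Fin n) →L[ℝ] _) :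
      EuclideanSpace ℝ (Fin n) →ₗ[ℝ] EuclideanSpace ℝ (Fin n)).IsSymmetric := fun v w => by
    have := isSymmetric_tiltedCov hK' 0 (R v) (R w)
    simp only [ContinuousLinearMap.coe_coe, ContinuousLinearMap.comp_apply] at this ⊢
    rw [hRsymm, this, hRsymm]
  have hlow := hsym.pow_le_det (c := 684⁻¹) (by norm_num) fun v => by
    simp only [ContinuousLinearMap.comp_apply]
    rw [hRsymm]
    rcases eq_or_ne v 0 with rfl | hv
    · simp
    have hRv : R v ≠ 0 := fun h => hv (S.symm.map_eq_zero_iff.1 h)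
    have h1 := inner_tiltedCov_zero_self_le hK hV (R v) (inner ℝ (tiltedMean K' 0) (R v))
    have h2 := hconv.setAverage_sq_le_of_subset hK hK' hsub hpos hvol (R v)
      (inner ℝ (tiltedMean K' 0) (R v)) (by
        simpa using setIntegral_mul_inner_sub_sq_pos hK' hV' (continuous_const (y := (1 : ℝ)))
          (fun _ => one_pos) hRv (inner ℝ (tiltedMean K' 0) (R v)))
    rw [← inner_tiltedCov_zero_self hK' hV'] at h2
    have h3 : inner ℝ (tiltedCov K 0 (R v)) (R v) = ‖v‖ ^ 2 := by
      rw [← hSS, hS]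
      simp only [hR, ContinuousLinearEquiv.coe_coe, S.apply_symm_apply]
      exact real_inner_self_eq_norm_sq v
    rw [h3] at h1
    linarith
  have hdetR : (S : EuclideanSpace ℝ (Fin n) →L[ℝ] EuclideanSpace ℝ (Fin n)).det * R.det = 1 := by
    have e : (S : EuclideanSpace ℝ (Fin n) →L[ℝ] EuclideanSpace ℝ (Fin n)).toLinearMap ∘ₗ
        R.toLinearMap = LinearMap.id := by
      ext1 v; exact S.apply_symm_apply v
    rw [ContinuousLinearMap.det, ContinuousLinearMap.det, ← LinearMap.det_comp, e, LinearMap.det_id]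
  have hdet : (R ∘L tiltedCov K' 0 ∘L R).det = R.det * ((tiltedCov K' 0).det * R.det) := by
    simp only [ContinuousLinearMap.det, ← LinearMap.det_comp]
    rfl
  rw [hdet] at hlow
  set s := (S : EuclideanSpace ℝ (Fin n) →L[ℝ] EuclideanSpace ℝ (Fin n)).det
  calc (684⁻¹ : ℝ) ^ n * s ^ 2 ≤ R.det * ((tiltedCov K' 0).det * R.det) * s ^ 2 := by gcongr
    _ = (s * R.det) ^ 2 * (tiltedCov K' 0).det := by ring
    _ = _ := by rw [hdetR]; ring

/-- The slicing bound for a body `K` all of whose convex subbodies satisfy the convexity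
hypothesis. -/
theorem pow_le_calC {B : ℝ} (hB : 0 ≤ B) (hn : 1 ≤ n)
    (H : ∀ K : ConvexBody (EuclideanSpace ℝ (Fin n)),
      (interior (K : Set (EuclideanSpace ℝ (Fin n)))).Nonempty →
        ConvexityHypothesis B (K : Set (EuclideanSpace ℝ (Fin n))))
    (hK : IsCompact K) (hconv : Convex ℝ K) (hV : volume K ≠ 0) :
    ((Real.exp (-(7 * B)) * 684⁻¹) ^ 2) ^ n ≤ calC K := by
  obtain ⟨S, hS, hSS⟩ := (isSymmetric_tiltedCov hK 0).exists_sqrt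
    fun v hv => inner_tiltedCov_self_pos hK hV 0 hv
  set b := tiltedMean K 0 with hb
  set s := (S : EuclideanSpace ℝ (Fin n) →L[ℝ] EuclideanSpace ℝ (Fin n)).det with hs
  have hdet : (tiltedCov K 0).det = s ^ 2 := by
    have e : (tiltedCov K 0).toLinearMap =
        (S : EuclideanSpace ℝ (Fin n) →L[ℝ] EuclideanSpace ℝ (Fin n)).toLinearMap ∘ₗ
          (S : EuclideanSpace ℝ (Fin n) →L[ℝ] EuclideanSpace ℝ (Fin n)).toLinearMap := by
      ext1 v; exact (hSS v).symm
    rw [hs, ContinuousLinearMap.det, ContinuousLinearMap.det, e, LinearMap.det_comp, sq]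
  have hs2 : 0 < s ^ 2 := hdet ▸ det_tiltedCov_pos hK hV 0
  have hs0 : s ≠ 0 := fun h => by simp [h] at hs2
  -- The convexity hypothesis is applied to K' rather than to K: on K' the exponent ⟨x - b, y⟩ is at
  -- most 7n for every y in Q.
  set K' := K ∩ {x | ‖S.symm (x - b)‖ ≤ 7 * √(n : ℝ)} with hK'def
  have hTc : IsClosed {x | ‖S.symm (x - b)‖ ≤ 7 * √(n : ℝ)} :=
    isClosed_le (by fun_prop) continuous_const
  have hK' : IsCompact K' := hK.inter_right hTc
  have hconv' : Convex ℝ K' := by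
    refine hconv.inter ?_
    have h1 := (convex_closedBall (0 : EuclideanSpace ℝ (Fin n)) (7 * √(n : ℝ))).linear_preimage
      (S.symm : EuclideanSpace ℝ (Fin n) →L[ℝ] EuclideanSpace ℝ (Fin n)).toLinearMap
    have h2 := h1.translate_preimage_right (-b)
    convert! h2 using 1
    ext x
    simp only [Set.mem_ofPred_eq, Set.mem_preimage, mem_closedBall_zero_iff, sub_eq_neg_add]
    rfl
  have hsub : K' ⊆ K := Set.inter_subset_left
  have hpos : 0 < volume.real K := ENNReal.toReal_pos hV hK.measure_ne_top
  have hvol : 37 * volume.real K ≤ 38 * volume.real K' :=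
    mul_volume_le_of_truncation hK hV hn hS hSS
  have hV' : volume K' ≠ 0 := fun h => by
    rw [Measure.real, Measure.real, h] at hvol
    simp only [ENNReal.toReal_zero, mul_zero] at hvol
    exact absurd hpos (not_lt.2 (by change (volume K).toReal ≤ 0; linarith))
  -- A convex set has null boundary, so a closed one of positive volume has interior points.
  have hint : (interior K').Nonempty := by
    by_contra h
    rw [Set.not_nonempty_iff_eq_empty] at h
    have := hconv'.addHaar_frontier volume
    rw [hK'.isClosed.frontier_eq, h, Set.sdiff_empty] at this
    exact hV' this
  have hu : ConvexityHypothesis B K' :=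
    H ⟨K', hconv', hK', hint.mono interior_subset⟩ hint
  set Q : Set (EuclideanSpace ℝ (Fin n)) :=
    (S : EuclideanSpace ℝ (Fin n) →L[ℝ] EuclideanSpace ℝ (Fin n)).toLinearMap ⁻¹'
      Metric.closedBall 0 √(n : ℝ) with hQ
  have hmemQ : ∀ y, y ∈ Q ↔ ‖S y‖ ≤ √(n : ℝ) := fun y => by
    simp [hQ]
  have hQm : MeasurableSet Q := by
    have : IsClosed Q := Metric.isClosed_closedBall.preimage S.continuous
    exact this.measurableSet
  have hQsymm : -Q = Q := by
    ext y
    rw [Set.mem_neg, hmemQ, hmemQ, map_neg, norm_neg]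
  have hinner : ∀ y ∈ Q, h₁ K' y ≤ inner ℝ b y + 7 * n := by
    intro y hy
    refine h₁_le_of_inner_le hK' hV' y fun x hx => ?_
    have h1 : inner ℝ (x - b) y = inner ℝ (S.symm (x - b)) (S y) := by
      rw [← hS, S.apply_symm_apply]
    have h2 := real_inner_le_norm (S.symm (x - b)) (S y)
    have h3 : ‖S.symm (x - b)‖ ≤ 7 * √(n : ℝ) := hx.2
    have h4 := mul_le_mul h3 ((hmemQ y).1 hy) (norm_nonneg _) (by positivity)
    rw [mul_assoc, Real.mul_self_sqrt (Nat.cast_nonneg n)] at h4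
    rw [inner_sub_left] at h1
    linarith
  -- The linear term ⟨b, y⟩ cancels between y and -y, so K need not be centred.
  have hD : ∀ y ∈ Q, h₁ K' y + h₁ K' (-y) ≤ 2 * (7 * n) := by
    intro y hy
    have h1 := hinner y hy
    have h2 := hinner (-y) (by rw [← hQsymm] at hy; exact hy)
    rw [inner_neg_right] at h2
    linarith
  have hmain := volume_mul_exp_mul_det_le hB hK' hconv' hV' hu hQm hQsymm hD
  -- Q is the preimage under S of a ball of volume at least 1.
  have hQvol : |s|⁻¹ ≤ volume.real Q := by
    have h1 := Measure.addHaar_preimage_linearMap volume (f := (S : EuclideanSpace ℝ (Fin n) →L[ℝ]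
      EuclideanSpace ℝ (Fin n)).toLinearMap) hs0 (Metric.closedBall 0 √(n : ℝ))
    rw [Measure.real, hQ, h1, ENNReal.toReal_mul, ENNReal.toReal_ofReal (abs_nonneg _), abs_inv]
    exact le_mul_of_one_le_right (by positivity) (EuclideanSpace.one_le_volume_closedBall_sqrt n)
  have hdet' := det_tiltedCov_le_of_subset hK hconv hV hK' hsub hV' hvol hS hSS
  rw [← hs] at hdet'
  have habs : 0 < |s| := abs_pos.2 hs0
  have hfin : (Real.exp (-(7 * B)) * 684⁻¹) ^ n * |s| ≤ volume.real K := by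
    calc (Real.exp (-(7 * B)) * 684⁻¹) ^ n * |s|
        = |s|⁻¹ * (Real.exp (-(B * (7 * n))) * ((684⁻¹ : ℝ) ^ n * s ^ 2)) := by
          rw [mul_pow, ← Real.exp_nat_mul, ← sq_abs s]
          have : (n : ℝ) * -(7 * B) = -(B * (7 * n)) := by ring
          rw [this]
          field_simp
      _ ≤ volume.real Q * (Real.exp (-(B * (7 * n))) * (tiltedCov K' 0).det) := by gcongr
      _ ≤ volume.real K' := hmain
      _ ≤ volume.real K := measureReal_mono hsub hK.measure_ne_top
  rw [calC, det_cov hK, hdet, le_div_iff₀ hs2, ← pow_mul, mul_comm 2 n, pow_mul, ← sq_abs s,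
    ← mul_pow]
  exact pow_le_pow_left₀ (by positivity) hfin 2

end Slicing

end

theorem corollary1p10
    (hB : ∃ B : ℝ, 0 < B ∧ ∀ n : ℕ, 1 ≤ n → ∀ K : ConvexBody (EuclideanSpace ℝ (Fin n)),
      (interior (K : Set (EuclideanSpace ℝ (Fin n)))).Nonempty →
        Slicing.ConvexityHypothesis B (K : Set (EuclideanSpace ℝ (Fin n)))) :
    Slicing.SlicingConjecture := by
  obtain ⟨B, hB, H⟩ := hB
  refine ⟨(Real.exp (-(7 * B)) * 684⁻¹) ^ 2, by positivity, fun n hn K hK => ?_⟩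
  exact Slicing.pow_le_calC hB.le hn (H n hn) K.isCompact K.convex
    (isOpen_interior.measure_pos volume hK |>.trans_le (measure_mono interior_subset)).ne'
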